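/- Let $n\ge 0$ and $s\ge 1$ be integers. For a real vector space $V$ of dimension $n(s+1)$ and $\omega_1,\dots,\omega_s\in\Lambda^2V^*$, a basis $v_1,\dots,v_n,w^1_1,\dots,w^s_n$ of $V$ is called standard polysymplectic if $\omega_j=\sum_{i=1}^n v_i^*\wedge (w^j_i)^*$ for all $j=1,\dots,s$, where $(\alpha\wedge\beta)(x,y)=\alpha(x)\beta(y)-\alpha(y)\beta(x)$. A polysymplectic manifold $(M,\omega_1,\dots,\omega_s)$ is a smooth manifold $M$ (Hausdorff, second countable, without boundary) of dimension $n(s+1)$ together with $s$ smooth differential $2$-forms such that: (a) every $\omega_j$ is closed; (b) for every $p\in M$ the tangent space $T_pM$ has a basis which is standard polysymplectic for $(\omega_1)_p,\dots,(\omega_s)_p$; (c) the distribution $\sum_j\omega_j^\perp$ is integrable, where $\omega_j^\perp$ is the space of tangent vectors which contract to zero with $\omega_j$. A smooth Riemannian metric $\mathbf g$ on $M$ is compatible with the polysymplectic structure if for every $p\in M$ there is a standard polysymplectic basis of $T_pM$ which is orthonormal with respect to $\mathbf g_p$. Theorem. Let $(M,\omega_1,\dots,\omega_s)$ be a polysymplectic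 manifold. The space of all smooth Riemannian metrics on $M$ compatible with the polysymplectic structure, with the $C^\infty$ compact-open topology (uniform convergence of the coefficients in charts, together with all their derivatives, on compact subsets of the charts), is non-empty and contractible. -/

import Mathlib

open scoped Manifold ContDiff Topology UniformConvergence

noncomputable section

namespace Polysymplectic

section LinearAlgebra

variable {V : Type*} [AddCommGroup V] [Module ℝ V] [TopologicalSpace V]

/-- The value `(α ∧ β)(x, y) = α(x) β(y) - α(y) β(x)` of the wedge product of two linear forms. -/
def wedge (α β : V →ₗ[ℝ] ℝ) (x y : V) : ℝ := α x * β y - α y * β x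

/-- A basis `v_i = b (inl i)`, `w^j_i = b (inr (j, i))` of `V` is standard polysymplectic for the
alternating forms `Ω_1, …, Ω_s` if `Ω_j = ∑ i, v_i^* ∧ (w^j_i)^*` for all `j`. -/
def IsStandardBasis {n s : ℕ} (Ω : Fin s → V [⋀^Fin 2]→L[ℝ] ℝ)
    (b : Module.Basis (Fin n ⊕ Fin s × Fin n) ℝ V) : Prop :=
  ∀ (j : Fin s) (x y : V),
    Ω j ![x, y] = ∑ i : Fin n, wedge (b.coord (Sum.inl i)) (b.coord (Sum.inr (j, i))) x y

/-- `Ω^⊥`: the vectors which contract to zero with `Ω`. -/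
def perp (Ω : V [⋀^Fin 2]→L[ℝ] ℝ) : Submodule ℝ V :=
  LinearMap.ker Ω.toAlternatingMap.curryLeft

/-- The basis `b` is orthonormal with respect to the bilinear form `g`. -/
def IsOrthonormalBasis {ι : Type*} (g : V →L[ℝ] V →L[ℝ] ℝ) (b : Module.Basis ι ℝ V) : Prop :=
  (∀ a, g (b a) (b a) = 1) ∧ ∀ a c, a ≠ c → g (b a) (b c) = 0

end LinearAlgebra

section Topology

variable {E F : Type*} [NormedAddCommGroup E] [NormedSpace ℝ E]
  [NormedAddCommGroup F] [NormedSpace ℝ F]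

/-- The topology of uniform convergence of the derivatives of all orders on the compact subsets
of the open set `U`. -/
@[reducible] def smoothCompactOpen (U : Set E) : TopologicalSpace (E → F) :=
  ⨅ k : ℕ, TopologicalSpace.induced
    (fun f => UniformOnFun.ofFun {K : Set E | IsCompact K ∧ K ⊆ U} (iteratedFDeriv ℝ k f))
    inferInstance

end Topology

section Manifold

variable {E : Type*} [NormedAddCommGroup E] [NormedSpace ℝ E]
  {M : Type*} [TopologicalSpace M] [ChartedSpace E M]

/-- Expression on the model space of a field of alternating `2`-forms in the chart `φ` at `x₀`:
the pullback by `φ⁻¹`. It is meaningful on the target of `φ` only. -/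
def formInChart (Ω : (p : M) → TangentSpace 𝓘(ℝ, E) p [⋀^Fin 2]→L[ℝ] ℝ) (x₀ : M) (y : E) :
    E [⋀^Fin 2]→L[ℝ] ℝ :=
  (Ω ((chartAt E x₀).symm y)).compContinuousLinearMap
    (mfderiv 𝓘(ℝ, E) 𝓘(ℝ, E) (chartAt E x₀).symm y)

/-- The field of alternating `2`-forms `Ω` is smooth, i.e. is a smooth differential `2`-form. -/
def IsSmoothForm (Ω : (p : M) → TangentSpace 𝓘(ℝ, E) p [⋀^Fin 2]→L[ℝ] ℝ) : Prop :=
  ∀ x₀ : M, ContDiffOn ℝ ∞ (formInChart Ω x₀) (chartAt E x₀).target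

/-- The differential `2`-form `Ω` is closed: `dΩ = 0` in charts. -/
def IsClosedForm (Ω : (p : M) → TangentSpace 𝓘(ℝ, E) p [⋀^Fin 2]→L[ℝ] ℝ) : Prop :=
  ∀ x₀ : M, ∀ y ∈ (chartAt E x₀).target, extDeriv (formInChart Ω x₀) y = 0

/-- A distribution `D` of tangent subspaces is (completely) integrable: around every point there is
a smooth chart which straightens `D`, i.e. in which `D` is a constant subspace `F` of the model
space, so that the slices parallel to `F` are integral manifolds of `D`. -/
def IsIntegrable (D : (p : M) → Submodule ℝ (TangentSpace 𝓘(ℝ, E) p)) : Prop :=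
  ∀ p : M, ∃ e ∈ IsManifold.maximalAtlas 𝓘(ℝ, E) ∞ M, p ∈ e.source ∧
    ∃ F : Submodule ℝ E, ∀ q ∈ e.source, ∀ v : TangentSpace 𝓘(ℝ, E) q,
      v ∈ D q ↔ mfderiv 𝓘(ℝ, E) 𝓘(ℝ, E) e q v ∈ F

/-- `(M, Ω_1, …, Ω_s)` is a polysymplectic manifold of dimension `n (s + 1)`. -/
structure IsPolysymplectic (n : ℕ) {s : ℕ}
    (Ω : Fin s → (p : M) → TangentSpace 𝓘(ℝ, E) p [⋀^Fin 2]→L[ℝ] ℝ) : Prop where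
  smooth : ∀ j, IsSmoothForm (Ω j)
  closed : ∀ j, IsClosedForm (Ω j)
  exists_standardBasis : ∀ p : M,
    ∃ b : Module.Basis (Fin n ⊕ Fin s × Fin n) ℝ (TangentSpace 𝓘(ℝ, E) p),
      IsStandardBasis (fun j => Ω j p) b
  integrable : IsIntegrable (fun p : M => ⨆ j, perp (Ω j p))

variable (E M) in
/-- Smooth Riemannian metrics on `M`. -/
abbrev SmoothMetric [IsManifold 𝓘(ℝ, E) ∞ M] :=
  Bundle.ContMDiffRiemannianMetric 𝓘(ℝ, E) ∞ E (fun p : M => TangentSpace 𝓘(ℝ, E) p)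

variable [IsManifold 𝓘(ℝ, E) ∞ M]

/-- Expression on the model space of a Riemannian metric in the chart `φ` at `x₀`: the pullback by
`φ⁻¹`. It is meaningful on the target of `φ` only. -/
def metricInChart (g : SmoothMetric E M) (x₀ : M) (y : E) : E →L[ℝ] E →L[ℝ] ℝ :=
  let G : E →L[ℝ] E →L[ℝ] ℝ := g.inner ((chartAt E x₀).symm y)
  let L : E →L[ℝ] E := mfderiv 𝓘(ℝ, E) 𝓘(ℝ, E) (chartAt E x₀).symm y
  G.bilinearComp L L

/-- The `C^∞` compact-open topology on the space of Riemannian metrics: uniform convergence of the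
coefficients in charts and of all their derivatives, on the compact subsets of the charts. -/
instance smoothMetricTopology : TopologicalSpace (SmoothMetric E M) :=
  ⨅ x₀ : M, TopologicalSpace.induced (fun g => metricInChart g x₀)
    (smoothCompactOpen (chartAt E x₀).target)

/-- The metric `g` is compatible with the polysymplectic structure: every tangent space has an
orthonormal standard polysymplectic basis. -/
def IsCompatible (n : ℕ) {s : ℕ}
    (Ω : Fin s → (p : M) → TangentSpace 𝓘(ℝ, E) p [⋀^Fin 2]→L[ℝ] ℝ) (g : SmoothMetric E M) :
    Prop :=
  ∀ p : M, ∃ b : Module.Basis (Fin n ⊕ Fin s × Fin n) ℝ (TangentSpace 𝓘(ℝ, E) p),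
    IsStandardBasis (fun j => Ω j p) b ∧ IsOrthonormalBasis (g.inner p) b

/-- The space of compatible metrics, with the topology induced by that of all metrics. -/
abbrev CompatibleMetric (n : ℕ) {s : ℕ}
    (Ω : Fin s → (p : M) → TangentSpace 𝓘(ℝ, E) p [⋀^Fin 2]→L[ℝ] ℝ) :=
  {g : SmoothMetric E M // IsCompatible n Ω g}

end Manifold

end Polysymplectic

end

open scoped Manifold ContDiff Topology UniformConvergence

set_option linter.unusedSectionVars false

noncomputable section

namespace Polysymplectic

/-! ### Composition and uniform convergence of derivatives on compact sets -/

section SmoothConvergence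

universe u

/-! Everything rests on a pointwise construction, `Interpolation`: a path joining any two compatible
scalar products on one vector space, through compatible ones, which is smooth in all its data and
commutes with linear isomorphisms. Naturality makes it computable in any chart, so it acts on smooth
fields. Applied at each point it contracts the space of compatible metrics to any chosen `g₀`; the
contraction is continuous because composition with a smooth map is continuous for uniform
convergence of all derivatives on compact sets (`tendstoUniformlyOn_iteratedFDeriv_comp`).

For one form, a compatible `g` is a scalar product whose operator `J`, given by `g (J x) y = σ x y`,
satisfies `J² = -1`. With `P = g₀⁻¹ g₁`, the path is the straight line in the Cayley coordinate `(P
- 1)(P + 1)⁻¹`.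

For two or more forms, the span `W` of the `w^j_i` is the same for all standard bases. A compatible
`g` amounts to a complement of `W` isotropic for all forms together with a scalar product on that
complement; the product on `W` is then dual to it through the forms. The projections with kernel `W`
and the horizontal products are both interpolated affinely, and `recForm` rebuilds a scalar product
from them.

Existence is first local. For one form, a square root near `1` carries the form at the base point to
the nearby forms. For several, a standard frame is deformed smoothly. Since compatible products are
not closed under convex combination, the local fields are glued by the interpolation itself, with
bump functions as its time parameter (`exists_global_field`). -/

theorem tendstoUniformlyOn_iteratedFDeriv_zero_iff {ι : Type*} {E F : Type*}
    [NormedAddCommGroup E] [NormedSpace ℝ E] [NormedAddCommGroup F] [NormedSpace ℝ F]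
    {l : Filter ι} {f : ι → E → F} {f₀ : E → F} {K : Set E} :
    TendstoUniformlyOn (fun i => iteratedFDeriv ℝ 0 (f i)) (iteratedFDeriv ℝ 0 f₀) l K ↔
      TendstoUniformlyOn f f₀ l K := by
  simp only [Metric.tendstoUniformlyOn_iff, iteratedFDeriv_zero_eq_comp, Function.comp_apply,
    LinearIsometryEquiv.dist_map]

theorem tendstoUniformlyOn_iteratedFDeriv_succ_iff {ι : Type*} {E F : Type*}
    [NormedAddCommGroup E] [NormedSpace ℝ E] [NormedAddCommGroup F] [NormedSpace ℝ F]
    {l : Filter ι} {f : ι → E → F} {f₀ : E → F} {K : Set E} {k : ℕ} :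
    TendstoUniformlyOn (fun i => iteratedFDeriv ℝ (k + 1) (f i)) (iteratedFDeriv ℝ (k + 1) f₀) l K ↔
      TendstoUniformlyOn (fun i => iteratedFDeriv ℝ k (fderiv ℝ (f i)))
        (iteratedFDeriv ℝ k (fderiv ℝ f₀)) l K := by
  simp only [Metric.tendstoUniformlyOn_iff, iteratedFDeriv_succ_eq_comp_right, Function.comp_apply,
    LinearIsometryEquiv.dist_map]

theorem tendstoUniformlyOn_iteratedFDeriv_prodMk {ι : Type*} {E F G : Type*}
    [NormedAddCommGroup E] [NormedSpace ℝ E] [NormedAddCommGroup F] [NormedSpace ℝ F]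
    [NormedAddCommGroup G] [NormedSpace ℝ G]
    {l : Filter ι} {f : ι → E → F} {f₀ : E → F} {g : ι → E → G} {g₀ : E → G} {U K : Set E} {k : ℕ}
    (hU : IsOpen U) (hf : ∀ i, ContDiffOn ℝ ∞ (f i) U) (hf₀ : ContDiffOn ℝ ∞ f₀ U)
    (hg : ∀ i, ContDiffOn ℝ ∞ (g i) U) (hg₀ : ContDiffOn ℝ ∞ g₀ U) (hK : K ⊆ U)
    (h : TendstoUniformlyOn (fun i => iteratedFDeriv ℝ k (f i)) (iteratedFDeriv ℝ k f₀) l K)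
    (h' : TendstoUniformlyOn (fun i => iteratedFDeriv ℝ k (g i)) (iteratedFDeriv ℝ k g₀) l K) :
    TendstoUniformlyOn (fun i => iteratedFDeriv ℝ k (fun y => (f i y, g i y)))
      (iteratedFDeriv ℝ k (fun y => (f₀ y, g₀ y))) l K := by
  rw [Metric.tendstoUniformlyOn_iff] at h h' ⊢
  intro ε hε
  filter_upwards [h ε hε, h' ε hε] with i hi hi' y hy
  have hy' := hU.mem_nhds (hK hy)
  have hk : (k : WithTop ℕ∞) ≤ ∞ := by exact_mod_cast le_top
  rw [iteratedFDeriv_prodMk ((hf₀.contDiffAt hy')) (hg₀.contDiffAt hy') hk,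
    iteratedFDeriv_prodMk ((hf i).contDiffAt hy') ((hg i).contDiffAt hy') hk]
  have e : (iteratedFDeriv ℝ k f₀ y).prod (iteratedFDeriv ℝ k g₀ y) -
      (iteratedFDeriv ℝ k (f i) y).prod (iteratedFDeriv ℝ k (g i) y) =
      (iteratedFDeriv ℝ k f₀ y - iteratedFDeriv ℝ k (f i) y).prod
        (iteratedFDeriv ℝ k g₀ y - iteratedFDeriv ℝ k (g i) y) := by
    ext <;> rfl
  rw [dist_eq_norm, e, ContinuousMultilinearMap.opNorm_prod, max_lt_iff, ← dist_eq_norm,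
    ← dist_eq_norm]
  exact ⟨hi y hy, hi' y hy⟩

/-- Composition with a smooth map is continuous for uniform convergence of all derivatives on a
compact set. -/
theorem tendstoUniformlyOn_iteratedFDeriv_comp {ι : Type*} {E : Type u}
    [NormedAddCommGroup E] [NormedSpace ℝ E] {l : Filter ι} {U K : Set E} (hU : IsOpen U)
    (hKc : IsCompact K) (hK : K ⊆ U) (k : ℕ) :
    ∀ {F G : Type u} [NormedAddCommGroup F] [NormedSpace ℝ F]
    [NormedAddCommGroup G] [NormedSpace ℝ G] {Φ : F → G} {O : Set F}
    (_ : ∀ z ∈ O, ContDiffAt ℝ ∞ Φ z) {f : ι → E → F} {f₀ : E → F}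
    (_ : ∀ i, ContDiffOn ℝ ∞ (f i) U) (_ : ContDiffOn ℝ ∞ f₀ U)
    (_ : ∀ i, Set.MapsTo (f i) U O) (_ : Set.MapsTo f₀ U O)
    (_ : ∀ m ≤ k, TendstoUniformlyOn (fun i => iteratedFDeriv ℝ m (f i))
      (iteratedFDeriv ℝ m f₀) l K),
    TendstoUniformlyOn (fun i => iteratedFDeriv ℝ k (Φ ∘ f i)) (iteratedFDeriv ℝ k (Φ ∘ f₀)) l K := by
  induction k with
  | zero =>
    intro F G _ _ _ _ Φ O hΦ f f₀ hf hf₀ hfO hf₀O h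
    have h0 := tendstoUniformlyOn_iteratedFDeriv_zero_iff.1 (h 0 le_rfl)
    rw [tendstoUniformlyOn_iteratedFDeriv_zero_iff]
    intro r hr
    have hc : IsCompact (f₀ '' K) := hKc.image_of_continuousOn (hf₀.continuousOn.mono hK)
    -- `Φ` is only known to be continuous at points of `O`; compactness of `f₀ '' K` still gives a
    -- uniform modulus for pairs with one point in that image.
    have := hc.uniformContinuousAt_of_continuousAt Φ (fun z hz => by
      obtain ⟨y, hy, rfl⟩ := hz
      exact (hΦ _ (hf₀O (hK hy))).continuousAt) hr
    filter_upwards [h0 _ this] with i hi y hy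
    exact hi y hy ⟨y, hy, rfl⟩
  | succ k ih =>
    intro F G _ _ _ _ Φ O hΦ f f₀ hf hf₀ hfO hf₀O h
    rw [tendstoUniformlyOn_iteratedFDeriv_succ_iff]
    have hfd : ∀ {g : E → F}, ContDiffOn ℝ ∞ g U → ContDiffOn ℝ ∞ (fderiv ℝ g) U :=
      fun hg y hy => ((hg.contDiffAt (hU.mem_nhds hy)).fderiv_right le_rfl).contDiffWithinAt
    have key : ∀ {g : E → F}, ContDiffOn ℝ ∞ g U → Set.MapsTo g U O → ∀ y ∈ K,
        iteratedFDeriv ℝ k ((fun p : F × (E →L[ℝ] F) => (fderiv ℝ Φ p.1).comp p.2) ∘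
          fun y => (g y, fderiv ℝ g y)) y = iteratedFDeriv ℝ k (fderiv ℝ (Φ ∘ g)) y := by
      intro g hg hgO y hy
      have : ((fun p : F × (E →L[ℝ] F) => (fderiv ℝ Φ p.1).comp p.2) ∘
          fun y => (g y, fderiv ℝ g y)) =ᶠ[𝓝 y] fderiv ℝ (Φ ∘ g) := by
        filter_upwards [hU.mem_nhds (hK hy)] with z hz
        rw [fderiv_comp z ((hΦ _ (hgO hz)).differentiableAt (by simp))
          ((hg.contDiffAt (hU.mem_nhds hz)).differentiableAt (by simp))]
        rfl
      exact (this.iteratedFDeriv ℝ k).eq_of_nhds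
    -- By the chain rule, the derivative of `Φ ∘ f` is again a composition: the pair `(f, f')`
    -- followed by the smooth map `(z, A) ↦ Φ'(z) ∘ A`. The induction therefore runs over all target
    -- spaces at once.
    have h1 := @ih (F × (E →L[ℝ] F)) (E →L[ℝ] G) _ _ _ _
      (fun p => (fderiv ℝ Φ p.1).comp p.2) (O ×ˢ Set.univ) (fun z hz =>
        (((hΦ z.1 hz.1).fderiv_right le_rfl).comp z contDiffAt_fst).clm_comp contDiffAt_snd)
      (fun i y => (f i y, fderiv ℝ (f i) y)) (fun y => (f₀ y, fderiv ℝ f₀ y))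
      (fun i => (hf i).prodMk (hfd (hf i))) (hf₀.prodMk (hfd hf₀))
      (fun i y hy => ⟨hfO i hy, trivial⟩) (fun y hy => ⟨hf₀O hy, trivial⟩)
      (fun m hm => tendstoUniformlyOn_iteratedFDeriv_prodMk hU hf hf₀ (fun i => hfd (hf i)) (hfd hf₀)
        hK (h m (by omega)) (tendstoUniformlyOn_iteratedFDeriv_succ_iff.1 (h (m + 1) (by omega))))
    refine (h1.congr_right (fun y hy => ?_)).congr (Filter.Eventually.of_forall fun i y hy => ?_)
    · exact key hf₀ hf₀O y hy
    · exact key (hf i) (hfO i) y hy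

end SmoothConvergence

end Polysymplectic

end

noncomputable section

namespace Polysymplectic

/-! ### Bilinear forms and their chart expressions -/

section Bilinear

variable {E : Type*} [NormedAddCommGroup E] [NormedSpace ℝ E]

variable (E) in
/-- Continuous bilinear forms. -/
abbrev Bil := E →L[ℝ] E →L[ℝ] ℝ

/-- The pullback of a bilinear form. -/
def pull (L : E →L[ℝ] E) (g : Bil E) : Bil E := g.bilinearComp L L

@[simp] theorem pull_apply (L : E →L[ℝ] E) (g : Bil E) (x y : E) : pull L g x y = g (L x) (L y) :=
  rfl

variable (E) in
/-- An alternating `2`-form as a bilinear form, depending linearly on the form. -/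
def toBil : (E [⋀^Fin 2]→L[ℝ] ℝ) →L[ℝ] Bil E :=
  ((ContinuousLinearMap.compL ℝ E (ContinuousMultilinearMap ℝ (fun _ : Fin 1 => E) ℝ) (E →L[ℝ] ℝ)
      (continuousMultilinearCurryFin1 ℝ E ℝ).toContinuousLinearEquiv.toContinuousLinearMap).comp
    (continuousMultilinearCurryLeftEquiv ℝ
      (fun _ : Fin 2 => E) ℝ).toContinuousLinearEquiv.toContinuousLinearMap).comp
    (ContinuousAlternatingMap.toContinuousMultilinearMapCLM ℝ)

theorem toBil_apply (Ω : E [⋀^Fin 2]→L[ℝ] ℝ) (x y : E) : toBil E Ω x y = Ω ![x, y] := by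
  change Ω (Fin.cons x (Fin.snoc 0 y)) = _
  congr 1
  ext i
  fin_cases i <;> simp

end Bilinear

section Charts

variable {E : Type*} [NormedAddCommGroup E] [NormedSpace ℝ E]
  {M : Type*} [TopologicalSpace M] [ChartedSpace E M]

/-- Expression in the chart at `x₀` of a field of bilinear forms. -/
def bilInChart (g : M → Bil E) (x₀ : M) (y : E) : Bil E :=
  pull (mfderiv 𝓘(ℝ, E) 𝓘(ℝ, E) (chartAt E x₀).symm y) (g ((chartAt E x₀).symm y))

variable [IsManifold 𝓘(ℝ, E) ∞ M]

theorem isInvertible_mfderiv_chart_symm (x₀ : M) {y : E} (hy : y ∈ (chartAt E x₀).target) :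
    ∃ L : E ≃L[ℝ] E, (L : E →L[ℝ] E) = mfderiv 𝓘(ℝ, E) 𝓘(ℝ, E) (chartAt E x₀).symm y := by
  have : IsManifold 𝓘(ℝ, E) 1 M := IsManifold.of_le (n := ∞) (by exact_mod_cast le_top)
  have h : y ∈ (extChartAt 𝓘(ℝ, E) x₀).target := by simpa [extChartAt] using hy
  have h' := isInvertible_mfderivWithin_extChartAt_symm h
  simp only [extChartAt, OpenPartialHomeomorph.extend, modelWithCornersSelf_partialEquiv,
    modelWithCornersSelf_coe, Set.range_id, mfderivWithin_univ] at h'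
  exact h'

/-- Smoothness of a field of bilinear forms can be read in any chart. -/
theorem contMDiffAt_bil_iff (g : M → Bil E) (x₀ : M) {p : M}
    (hp : p ∈ (chartAt E x₀).source) :
    ContMDiffAt 𝓘(ℝ, E) (𝓘(ℝ, E).prod 𝓘(ℝ, E →L[ℝ] E →L[ℝ] ℝ)) ∞
      (fun p : M => Bundle.TotalSpace.mk' (E →L[ℝ] E →L[ℝ] ℝ)
        (E := fun p : M => TangentSpace 𝓘(ℝ, E) p →L[ℝ] TangentSpace 𝓘(ℝ, E) p →L[ℝ] ℝ) p (g p)) p ↔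
      ContDiffAt ℝ ∞ (bilInChart g x₀) (chartAt E x₀ p) := by
  have : IsManifold 𝓘(ℝ, E) 1 M := IsManifold.of_le (n := ∞) (by exact_mod_cast le_top)
  let e := trivializationAt (E →L[ℝ] E →L[ℝ] ℝ)
    (fun p : M => TangentSpace 𝓘(ℝ, E) p →L[ℝ] TangentSpace 𝓘(ℝ, E) p →L[ℝ] ℝ) x₀
  have hp' : p ∈ e.baseSet := by simpa [e] using hp
  refine (Bundle.Trivialization.contMDiffAt_section_iff (F := E →L[ℝ] E →L[ℝ] ℝ) (B := M)
    (E := fun p : M => TangentSpace 𝓘(ℝ, E) p →L[ℝ] TangentSpace 𝓘(ℝ, E) p →L[ℝ] ℝ) (s := g)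
    (n := ∞) (𝕜 := ℝ) (IB := 𝓘(ℝ, E)) e hp').trans ?_
  rw [contMDiffAt_iff_source_of_mem_source (x := x₀) hp]
  simp only [extChartAt, OpenPartialHomeomorph.extend, modelWithCornersSelf_partialEquiv,
    PartialEquiv.trans_refl, OpenPartialHomeomorph.coe_toPartialEquiv_symm, modelWithCornersSelf_coe,
    Set.range_id, contMDiffWithinAt_univ, OpenPartialHomeomorph.toFun_eq_coe,
    contMDiffAt_iff_contDiffAt]
  suffices h : _ =ᶠ[𝓝 (chartAt E x₀ p)] bilInChart g x₀ from
    ⟨fun h' => h'.congr_of_eventuallyEq h.symm, fun h' => h'.congr_of_eventuallyEq h⟩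
  filter_upwards [(chartAt E x₀).open_target.mem_nhds ((chartAt E x₀).map_source hp)] with y hy
  have hy' := (chartAt E x₀).map_target hy
  -- The inverse of the tangent trivialization at `x₀` is the derivative of the inverse chart, so
  -- the bundle coordinates of `g` are its pullback `bilInChart`.
  have ev : ∀ v : E, (trivializationAt E (TangentSpace 𝓘(ℝ, E)) x₀).symm ((chartAt E x₀).symm y) v =
      (mfderiv 𝓘(ℝ, E) 𝓘(ℝ, E) (chartAt E x₀).symm y : E →L[ℝ] E) v := by
    have aux : ∀ z, z = y → (mfderivWithin 𝓘(ℝ, E) 𝓘(ℝ, E) (chartAt E x₀).symm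
        (Set.range id) z : E →L[ℝ] E) = mfderiv 𝓘(ℝ, E) 𝓘(ℝ, E) (chartAt E x₀).symm y := by
      rintro _ rfl
      rw [Set.range_id, mfderivWithin_univ]
    intro v
    rw [← aux _ ((chartAt E x₀).right_inv hy)]
    refine (Bundle.Trivialization.symmL_apply (R := ℝ) _ (by simpa using hy') v).symm.trans ?_
    exact DFunLike.congr_fun (TangentBundle.symmL_trivializationAt (I := 𝓘(ℝ, E)) hy') v
  ext v w
  refine (inCoordinates_apply_eq₂ (by simpa using hy') (by simpa using hy') (by simp)).trans ?_
  have triv : ∀ (q : M) (r : ℝ),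
      (trivializationAt ℝ (Bundle.Trivial M ℝ) x₀).linearMapAt ℝ q r = r := by simp
  refine (triv _ _).trans ?_
  exact congrArg₂ (fun a b => g ((chartAt E x₀).symm y) a b) (ev v) (ev w)

end Charts

end Polysymplectic

end

noncomputable section

namespace Polysymplectic

/-! ### Linear algebra of standard and orthonormal bases -/

section Compatible

variable {E : Type*} [NormedAddCommGroup E] [NormedSpace ℝ E] {n s : ℕ}

/-- The basis `b` is standard polysymplectic for the bilinear forms `σ_j`. -/
def IsStd (σ : Fin s → Bil E) (b : Module.Basis (Fin n ⊕ Fin s × Fin n) ℝ E) : Prop :=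
  ∀ (j : Fin s) (x y : E),
    σ j x y = ∑ i : Fin n, wedge (b.coord (Sum.inl i)) (b.coord (Sum.inr (j, i))) x y

variable (n) in
/-- The bilinear form `g` has an orthonormal basis which is standard polysymplectic for `σ`. -/
def IsCompat (σ : Fin s → Bil E) (g : Bil E) : Prop :=
  ∃ b : Module.Basis (Fin n ⊕ Fin s × Fin n) ℝ E, IsStd σ b ∧ IsOrthonormalBasis g b

/-- The bilinear form `g` is symmetric and positive definite. -/
def IsPos (g : Bil E) : Prop := (∀ x y, g x y = g y x) ∧ ∀ x, x ≠ 0 → 0 < g x x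

namespace IsStd

variable {σ : Fin s → Bil E} {b : Module.Basis (Fin n ⊕ Fin s × Fin n) ℝ E}

theorem skew (h : IsStd σ b) (j : Fin s) (x y : E) : σ j x y = - σ j y x := by
  rw [h, h, ← Finset.sum_neg_distrib]
  exact Finset.sum_congr rfl fun i _ => by simp only [wedge]; ring

theorem apply_inl (h : IsStd σ b) (j : Fin s) (x : E) (i : Fin n) :
    σ j (b (Sum.inl i)) x = b.coord (Sum.inr (j, i)) x := by
  rw [h, Finset.sum_eq_single i]
  · simp [wedge]
  · intro k _ hk
    simp [wedge, hk.symm]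
  · simp

theorem apply_inr (h : IsStd σ b) (j l : Fin s) (x : E) (i : Fin n) :
    σ j x (b (Sum.inr (l, i))) = if l = j then b.coord (Sum.inl i) x else 0 := by
  rw [h]
  split_ifs with hl
  · subst hl
    rw [Finset.sum_eq_single i]
    · simp [wedge]
    · intro k _ hk
      simp [wedge, hk.symm]
    · simp
  · refine Finset.sum_eq_zero fun k _ => ?_
    simp [wedge, hl]

theorem pull (h : IsStd σ b) (L : E ≃L[ℝ] E) :
    IsStd (fun j => pull (L : E →L[ℝ] E) (σ j)) (b.map L.symm.toLinearEquiv) := by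
  intro j x y
  rw [pull_apply, h]
  simp [wedge, Module.Basis.coord_apply]

end IsStd

theorem isOrthonormalBasis_apply {ι : Type*} [Fintype ι] {g : Bil E} {b : Module.Basis ι ℝ E}
    (h : IsOrthonormalBasis g b) (x : E) (a : ι) : g x (b a) = b.coord a x := by
  classical
  conv_lhs => rw [← b.sum_repr x]
  simp only [map_sum, map_smul, sum_apply, smul_apply,
    smul_eq_mul]
  rw [Finset.sum_eq_single a]
  · simp [h.1 a]
  · intro c _ hc
    rw [h.2 c a hc, mul_zero]
  · simp

theorem isOrthonormalBasis_eq_sum {ι : Type*} [Fintype ι] {g : Bil E} {b : Module.Basis ι ℝ E}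
    (h : IsOrthonormalBasis g b) (x y : E) : g x y = ∑ a, b.coord a x * b.coord a y := by
  conv_lhs => rw [← b.sum_repr y]
  simp only [map_sum, map_smul, smul_eq_mul]
  refine Finset.sum_congr rfl fun a _ => ?_
  rw [isOrthonormalBasis_apply h, mul_comm]
  rfl

theorem IsOrthonormalBasis.eq {ι : Type*} [Fintype ι] {g g' : Bil E} {b : Module.Basis ι ℝ E}
    (h : IsOrthonormalBasis g b) (h' : IsOrthonormalBasis g' b) : g = g' := by
  ext x y
  rw [isOrthonormalBasis_eq_sum h, isOrthonormalBasis_eq_sum h']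

theorem IsOrthonormalBasis.isPos {ι : Type*} [Fintype ι] {g : Bil E} {b : Module.Basis ι ℝ E}
    (h : IsOrthonormalBasis g b) : IsPos g := by
  refine ⟨fun x y => ?_, fun x hx => ?_⟩
  · rw [isOrthonormalBasis_eq_sum h, isOrthonormalBasis_eq_sum h]
    exact Finset.sum_congr rfl fun a _ => mul_comm _ _
  · rw [isOrthonormalBasis_eq_sum h]
    obtain ⟨a, ha⟩ : ∃ a, b.coord a x ≠ 0 := by
      by_contra! hc
      exact hx ((b.forall_coord_eq_zero_iff).1 hc)
    exact Finset.sum_pos' (fun a _ => mul_self_nonneg _) ⟨a, Finset.mem_univ _, mul_self_pos.2 ha⟩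

theorem IsCompat.isPos {σ : Fin s → Bil E} {g : Bil E} (h : IsCompat n σ g) : IsPos g :=
  let ⟨_, _, hb⟩ := h
  hb.isPos

theorem IsCompat.pull {σ : Fin s → Bil E} {g : Bil E} (h : IsCompat n σ g) (L : E ≃L[ℝ] E) :
    IsCompat n (fun j => pull (L : E →L[ℝ] E) (σ j)) (Polysymplectic.pull (L : E →L[ℝ] E) g) := by
  obtain ⟨b, hb, hg⟩ := h
  refine ⟨_, hb.pull L, ?_, ?_⟩
  · simpa using hg.1
  · simpa using hg.2

/-- A family of vectors with the values of a standard basis which is orthonormal is a basis. -/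
theorem isCompat_of_family [FiniteDimensional ℝ E] {σ : Fin s → Bil E} {g : Bil E}
    (hcard : Module.finrank ℝ E = Fintype.card (Fin n ⊕ Fin s × Fin n))
    (hskew : ∀ j x y, σ j x y = - σ j y x)
    (v : Fin n → E) (w : Fin s → Fin n → E)
    (hvv : ∀ j i k, σ j (v i) (v k) = 0)
    (hvw : ∀ j i l k, σ j (v i) (w l k) = if l = j ∧ k = i then 1 else 0)
    (hww : ∀ j l i m k, σ j (w l i) (w m k) = 0)
    (gvv : ∀ i k, g (v i) (v k) = if i = k then 1 else 0)
    (gvw : ∀ i l k, g (v i) (w l k) = 0) (gwv : ∀ i l k, g (w l k) (v i) = 0)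
    (gww : ∀ l i m k, g (w l i) (w m k) = if l = m ∧ i = k then 1 else 0) :
    IsCompat n σ g := by
  classical
  let e : Fin n ⊕ Fin s × Fin n → E := Sum.elim v fun p => w p.1 p.2
  have hg : ∀ a c, g (e a) (e c) = if a = c then 1 else 0 := by
    rintro (i | ⟨l, i⟩) (k | ⟨m, k⟩) <;> simp [e, gvv, gvw, gwv, gww]
  have hli : LinearIndependent ℝ e := by
    rw [Fintype.linearIndependent_iff]
    intro c hc a
    have := congrArg (fun x => g x (e a)) hc
    simpa [hg, -Fintype.sum_sum_type] using this
  have hb : ∀ a, basisOfLinearIndependentOfCardEqFinrank' e hli hcard.symm a = e a := fun a => by simp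
  generalize basisOfLinearIndependentOfCardEqFinrank' e hli hcard.symm = b at hb
  refine ⟨b, fun j x y => ?_, fun a => by simp [hb, hg], fun a c hac => by simp [hb, hg, hac]⟩
  let B : E →ₗ[ℝ] E →ₗ[ℝ] ℝ := LinearMap.mk₂ ℝ
    (fun x y => ∑ i : Fin n, wedge (b.coord (Sum.inl i)) (b.coord (Sum.inr (j, i))) x y)
    (fun x x' y => by
      simp only [wedge, map_add, ← Finset.sum_add_distrib]
      exact Finset.sum_congr rfl fun _ _ => by ring)
    (fun c x y => by
      simp only [wedge, map_smul, smul_eq_mul, Finset.mul_sum]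
      exact Finset.sum_congr rfl fun _ _ => by ring)
    (fun x y y' => by
      simp only [wedge, map_add, ← Finset.sum_add_distrib]
      exact Finset.sum_congr rfl fun _ _ => by ring)
    (fun c x y => by
      simp only [wedge, map_smul, smul_eq_mul, Finset.mul_sum]
      exact Finset.sum_congr rfl fun _ _ => by ring)
  -- Two bilinear forms agreeing on pairs of basis vectors are equal; the four cases are the
  -- pairings `vv`, `vw`, `wv`, `ww`.
  have key : (σ j).toLinearMap₁₂ = B := by
    refine LinearMap.ext_basis b b ?_
    rintro (i | ⟨l, i⟩) (k | ⟨m, k⟩) <;>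
      simp only [ContinuousLinearMap.toLinearMap₁₂_apply, B, LinearMap.mk₂_apply, wedge,
        Module.Basis.coord_apply, Module.Basis.repr_self, Finsupp.single_apply]
    · simp [hb, e, hvv]
    · by_cases hm : m = j <;> by_cases hk : k = i <;> simp [hb, e, hvw, hm, hk]
      exact Ne.symm hk
    · change σ j (b _) (b _) = _
      rw [hskew]
      by_cases hl : l = j <;> by_cases hk : i = k <;> simp [hb, e, hvw, hl, hk]
      exact Ne.symm hk
    · simp [hb, e, hww]
  exact congrArg (fun B => B x y) key

end Compatible

end Polysymplectic

end

noncomputable section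

namespace Polysymplectic

/-! ### Operators relating a scalar product to a bilinear form, and the notion of interpolation -/

section Positive

variable {E : Type*} [NormedAddCommGroup E] [NormedSpace ℝ E] [FiniteDimensional ℝ E]

theorem exists_equiv_of_injective {g : Bil E} (h : ∀ x, g x = 0 → x = 0) :
    ∃ e : E ≃L[ℝ] (E →L[ℝ] ℝ), (e : E →L[ℝ] (E →L[ℝ] ℝ)) = g := by
  have hinj : Function.Injective (g : E →ₗ[ℝ] (E →L[ℝ] ℝ)) :=
    (injective_iff_map_eq_zero _).2 h
  have hdim : Module.finrank ℝ E = Module.finrank ℝ (E →L[ℝ] ℝ) := by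
    rw [← (LinearMap.toContinuousLinearMap (E := E) (F' := ℝ) (𝕜 := ℝ)).finrank_eq]
    exact Subspace.dual_finrank_eq.symm
  refine ⟨(LinearEquiv.ofInjectiveOfFinrankEq _ hinj hdim).toContinuousLinearEquiv, ?_⟩
  ext x y
  rfl

theorem IsPos.exists_equiv {g : Bil E} (h : IsPos g) :
    ∃ e : E ≃L[ℝ] (E →L[ℝ] ℝ), (e : E →L[ℝ] (E →L[ℝ] ℝ)) = g :=
  exists_equiv_of_injective fun x hx => by
    by_contra hne
    simpa [hx] using h.2 x hne

/-- The operator `A` with `g(A x, y) = h(x, y)`. -/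
def transfer (g h : Bil E) : E →L[ℝ] E := (ContinuousLinearMap.inverse g).comp h

theorem apply_transfer {g : Bil E} (hg : IsPos g) (h : Bil E) (x y : E) :
    g (transfer g h x) y = h x y := by
  obtain ⟨e, rfl⟩ := hg.exists_equiv
  simp [transfer]

theorem IsPos.ext {g : Bil E} (hg : IsPos g) {x x' : E} (h : ∀ y, g x y = g x' y) : x = x' := by
  obtain ⟨e, rfl⟩ := hg.exists_equiv
  exact e.injective (ContinuousLinearMap.ext h)

theorem transfer_eq {g : Bil E} (hg : IsPos g) {h : Bil E} {A : E →L[ℝ] E}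
    (hA : ∀ x y, g (A x) y = h x y) : transfer g h = A := by
  ext x
  exact hg.ext fun y => by rw [apply_transfer hg, hA]

theorem contDiffAt_transfer {g h : Bil E} (hg : IsPos g) :
    ContDiffAt ℝ ∞ (fun p : Bil E × Bil E => transfer p.1 p.2) (g, h) := by
  obtain ⟨e, rfl⟩ := hg.exists_equiv
  exact ((contDiffAt_map_inverse e).comp (e.toContinuousLinearMap, h) contDiffAt_fst).clm_comp
    contDiffAt_snd

theorem transfer_pull {g : Bil E} (hg : IsPos g) (h : Bil E) (L : E ≃L[ℝ] E) :
    transfer (pull (L : E →L[ℝ] E) g) (pull (L : E →L[ℝ] E) h) =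
      (L.symm : E →L[ℝ] E).comp ((transfer g h).comp (L : E →L[ℝ] E)) := by
  have hg' : IsPos (pull (L : E →L[ℝ] E) g) :=
    ⟨fun x y => hg.1 _ _, fun x hx => hg.2 _ (by simpa using hx)⟩
  refine transfer_eq hg' fun x y => ?_
  simp [apply_transfer hg]

end Positive

/-- A smooth natural way of joining compatible scalar products. -/
structure Interpolation (E : Type*) [NormedAddCommGroup E] [NormedSpace ℝ E] (n s : ℕ) where
  toFun : (Fin s → Bil E) × Bil E × Bil E × ℝ → Bil E
  compat : ∀ {σ g₀ g₁ t}, IsCompat n σ g₀ → IsCompat n σ g₁ → t ∈ Set.Icc (0 : ℝ) 1 →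
    IsCompat n σ (toFun (σ, g₀, g₁, t))
  zero : ∀ {σ g₀ g₁}, IsCompat n σ g₀ → IsCompat n σ g₁ → toFun (σ, g₀, g₁, 0) = g₀
  one : ∀ {σ g₀ g₁}, IsCompat n σ g₀ → IsCompat n σ g₁ → toFun (σ, g₀, g₁, 1) = g₁
  smooth : ∀ {σ g₀ g₁ t}, IsCompat n σ g₀ → IsCompat n σ g₁ → t ∈ Set.Icc (0 : ℝ) 1 →
    ContDiffAt ℝ ∞ toFun (σ, g₀, g₁, t)
  natural : ∀ {σ g₀ g₁ t}, IsCompat n σ g₀ → IsCompat n σ g₁ → t ∈ Set.Icc (0 : ℝ) 1 →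
    ∀ L : E ≃L[ℝ] E, pull (L : E →L[ℝ] E) (toFun (σ, g₀, g₁, t)) =
      toFun (fun j => pull (L : E →L[ℝ] E) (σ j), pull (L : E →L[ℝ] E) g₀,
        pull (L : E →L[ℝ] E) g₁, t)

/-! ### One form: complex structures and the Cayley path -/

section Symplectic

variable {E : Type*} [NormedAddCommGroup E] [NormedSpace ℝ E] [FiniteDimensional ℝ E] {n : ℕ}

/-- In an orthonormal standard basis the operator sends `v_i` to `w_i` and `w_i` to `-v_i`. -/
theorem IsCompat.exists_complexStructure {σ : Fin 1 → Bil E} {g : Bil E} (h : IsCompat n σ g) :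
    ∃ J : E →L[ℝ] E, (∀ x y, g (J x) y = σ 0 x y) ∧ ∀ x, J (J x) = -x := by
  obtain ⟨b, hb, hg⟩ := h
  refine ⟨transfer g (σ 0), fun x y => apply_transfer hg.isPos _ _ _, fun x => ?_⟩
  have hc : ∀ x a, b.coord a (transfer g (σ 0) x) = σ 0 x (b a) := fun x a => by
    rw [← isOrthonormalBasis_apply hg, apply_transfer hg.isPos]
  refine b.ext_elem fun a => ?_
  rw [← b.coord_apply, ← b.coord_apply, hc, map_neg]
  rcases a with i | ⟨l, i⟩
  · rw [hb.skew, hb.apply_inl, hc, hb.apply_inr, if_pos rfl]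
  · rw [Subsingleton.elim l 0, hb.apply_inr, if_pos rfl, hc, hb.skew, hb.apply_inl]

/-- Converse to `IsCompat.exists_complexStructure`. Isotropic orthonormal vectors `v_i` are chosen
one at a time; the `J v_i` complete them, since `J` is an isometry for `g`. -/
theorem isCompat_of_complexStructure {σ : Fin 1 → Bil E} {g : Bil E}
    (hcard : Module.finrank ℝ E = Fintype.card (Fin n ⊕ Fin 1 × Fin n))
    (hg : IsPos g) (hσ : ∀ x y, σ 0 x y = - σ 0 y x) {J : E →L[ℝ] E}
    (hJ : ∀ x y, g (J x) y = σ 0 x y) (hJJ : ∀ x, J (J x) = -x) : IsCompat n σ g := by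
  have hisom : ∀ x y, g (J x) (J y) = g x y := fun x y => by
    rw [hJ, hσ, ← hJ, hJJ, hg.1]
    simp
  have hfam : ∀ k ≤ n, ∃ v : ℕ → E, (∀ i < k, ∀ j < k, g (v i) (v j) = if i = j then 1 else 0) ∧
      ∀ i < k, ∀ j < k, σ 0 (v i) (v j) = 0 := by
    intro k
    induction k with
    | zero => exact fun _ => ⟨0, by simp, by simp⟩
    | succ k ih =>
      intro hk
      obtain ⟨v, hv, hv'⟩ := ih (by omega)
      -- Orthogonality to the `k` earlier vectors for `g` and for `σ 0` imposes `2 k` linear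
      -- conditions, in dimension `2 n` with `k < n`.
      obtain ⟨u, hu, hu0⟩ : ∃ u ∈ LinearMap.ker ((LinearMap.pi fun i : Fin k =>
          (g (v i) : E →ₗ[ℝ] ℝ)).prod (LinearMap.pi fun i : Fin k => (σ 0 (v i) : E →ₗ[ℝ] ℝ))),
          u ≠ 0 := by
        refine (Submodule.ne_bot_iff _).1 (LinearMap.ker_ne_bot_of_finrank_lt ?_)
        simp only [hcard, Module.finrank_prod, Module.finrank_fin_fun, Fintype.card_sum,
          Fintype.card_prod, Fintype.card_fin]
        omega
      have hu1 : ∀ i < k, g (v i) u = 0 := fun i hi => congrFun (congrArg Prod.fst hu) ⟨i, hi⟩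
      have hu2 : ∀ i < k, σ 0 (v i) u = 0 := fun i hi => congrFun (congrArg Prod.snd hu) ⟨i, hi⟩
      have hpos := hg.2 u hu0
      set c := (Real.sqrt (g u u))⁻¹ with hc
      have hcc : c * (c * g u u) = 1 := by
        rw [← mul_assoc, hc, ← mul_inv, Real.mul_self_sqrt hpos.le, inv_mul_cancel₀ hpos.ne']
      have hσ0 : σ 0 u u = 0 := by linarith [hσ u u]
      refine ⟨Function.update v k (c • u), fun i hi j hj => ?_, fun i hi j hj => ?_⟩
      · rcases Nat.lt_succ_iff_lt_or_eq.1 hi with hi | rfl <;>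
          rcases Nat.lt_succ_iff_lt_or_eq.1 hj with hj | rfl
        · simp [hi.ne, hj.ne, hv i hi j hj]
        · simp [hi.ne, hu1 i hi]
        · simp [hj.ne, hj.ne', hg.1 u, hu1 j hj]
        · simp [hcc]
      · rcases Nat.lt_succ_iff_lt_or_eq.1 hi with hi | rfl <;>
          rcases Nat.lt_succ_iff_lt_or_eq.1 hj with hj | rfl
        · simp [hi.ne, hj.ne, hv' i hi j hj]
        · simp [hi.ne, hu2 i hi]
        · simp [hj.ne, hσ u, hu2 j hj]
        · simp [hσ0]
  obtain ⟨v, hv, hv'⟩ := hfam n le_rfl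
  have hv1 : ∀ i k : Fin n, g (v i) (v k) = if i = k then 1 else 0 := fun i k => by
    simp [hv i i.2 k k.2, Fin.ext_iff]
  have hv2 : ∀ i k : Fin n, σ 0 (v i) (v k) = 0 := fun i k => hv' i i.2 k k.2
  refine isCompat_of_family hcard (fun j => by rwa [Subsingleton.elim j 0]) (fun i => v i)
    (fun _ i => J (v i)) (fun j => ?_) (fun j i l k => ?_) (fun j l i m k => ?_) hv1
    (fun i l k => ?_) (fun i l k => ?_) (fun l i m k => ?_)
  · rwa [Subsingleton.elim j 0]
  · rw [Subsingleton.elim j 0, Subsingleton.elim l 0, ← hJ, hisom, hv1]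
    simp [eq_comm]
  · rw [Subsingleton.elim j 0, ← hJ, hJJ, map_neg, neg_apply, hg.1, hJ, hv2, neg_zero]
  · rw [hg.1, hJ, hv2]
  · rw [hJ, hv2]
  · rw [Subsingleton.elim l m, hisom, hv1]
    simp

/-- The Cayley interpolation `g₀ ((1 + t) P + (1 - t)) ((1 - t) P + (1 + t))⁻¹`, `P = g₀⁻¹ g₁`. -/
def cayley (p : (Fin 1 → Bil E) × Bil E × Bil E × ℝ) : Bil E :=
  p.2.1.comp (((1 + p.2.2.2) • transfer p.2.1 p.2.2.1 + (1 - p.2.2.2) • (1 : E →L[ℝ] E)) *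
    Ring.inverse ((1 - p.2.2.2) • transfer p.2.1 p.2.2.1 + (1 + p.2.2.2) • (1 : E →L[ℝ] E)))

variable {g₀ g₁ : Bil E} {t : ℝ}

/-- For `x` in the kernel, pairing with `x` under `g₀` gives `(1 - t) g₁(x, x) + (1 + t) g₀(x, x) =
0`, which forces `x = 0`. -/
theorem isUnit_cayley_denominator (h₀ : IsPos g₀) (h₁ : IsPos g₁) (ht : t ∈ Set.Icc (0 : ℝ) 1) :
    IsUnit ((1 - t) • transfer g₀ g₁ + (1 + t) • (1 : E →L[ℝ] E)) := by
  have hinj : Function.Injective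
      (((1 - t) • transfer g₀ g₁ + (1 + t) • (1 : E →L[ℝ] E) : E →L[ℝ] E) : E →ₗ[ℝ] E) := by
    refine (injective_iff_map_eq_zero _).2 fun x hx => ?_
    by_contra hne
    have hx' : (1 - t) * g₁ x x + (1 + t) * g₀ x x = 0 := by
      have := congrArg (fun z => g₀ z x) hx
      simpa [apply_transfer h₀] using this
    nlinarith [h₀.2 x hne, h₁.2 x hne, ht.1, ht.2, mul_nonneg (sub_nonneg.2 ht.2) (h₁.2 x hne).le,
      mul_nonneg ht.1 (h₀.2 x hne).le]
  let e := (LinearEquiv.ofInjectiveEndo _ hinj).toContinuousLinearEquiv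
  exact ⟨ContinuousLinearEquiv.toUnit e, by ext; rfl⟩

/-- The substitution `x = ((1 - t) P + (1 + t)) z` removes the inverse. By
`exists_cayley_denominator_eq` every vector has this form, so the properties of `cayley` are checked
as polynomial identities in `z`. -/
theorem cayley_apply_denominator (σ : Fin 1 → Bil E) (h₀ : IsPos g₀) (h₁ : IsPos g₁)
    (ht : t ∈ Set.Icc (0 : ℝ) 1) (z y : E) :
    cayley (σ, g₀, g₁, t) ((1 - t) • transfer g₀ g₁ z + (1 + t) • z) y =
      (1 + t) * g₁ z y + (1 - t) * g₀ z y := by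
  have h := Ring.inverse_mul_cancel _ (isUnit_cayley_denominator h₀ h₁ ht)
  have hz : Ring.inverse ((1 - t) • transfer g₀ g₁ + (1 + t) • (1 : E →L[ℝ] E))
      ((1 - t) • transfer g₀ g₁ z + (1 + t) • z) = z := DFunLike.congr_fun h z
  change g₀ (((1 + t) • transfer g₀ g₁ + (1 - t) • (1 : E →L[ℝ] E)) (Ring.inverse
    ((1 - t) • transfer g₀ g₁ + (1 + t) • (1 : E →L[ℝ] E)) _)) y = _
  rw [hz]
  simp [apply_transfer h₀]

theorem exists_cayley_denominator_eq (h₀ : IsPos g₀) (h₁ : IsPos g₁)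
    (ht : t ∈ Set.Icc (0 : ℝ) 1) (x : E) :
    ∃ z, (1 - t) • transfer g₀ g₁ z + (1 + t) • z = x :=
  ⟨_, DFunLike.congr_fun (Ring.mul_inverse_cancel _ (isUnit_cayley_denominator h₀ h₁ ht)) x⟩

theorem cayley_eq {σ : Fin 1 → Bil E} (h₀ : IsPos g₀) (h₁ : IsPos g₁)
    (ht : t ∈ Set.Icc (0 : ℝ) 1) {g : Bil E}
    (hg : ∀ z y, g ((1 - t) • transfer g₀ g₁ z + (1 + t) • z) y =
      (1 + t) * g₁ z y + (1 - t) * g₀ z y) : cayley (σ, g₀, g₁, t) = g := by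
  ext x y
  obtain ⟨z, rfl⟩ := exists_cayley_denominator_eq h₀ h₁ ht x
  rw [hg, cayley_apply_denominator σ h₀ h₁ ht]

/-- On `x = ((1 - t) P + (1 + t)) z` the quadratic form is `(1 - t²)(g₀(Pz, Pz) + g₀(z, z)) + ((1 +
t)² + (1 - t)²) g₁(z, z)`. -/
theorem isPos_cayley {σ : Fin 1 → Bil E} (h₀ : IsPos g₀) (h₁ : IsPos g₁)
    (ht : t ∈ Set.Icc (0 : ℝ) 1) : IsPos (cayley (σ, g₀, g₁, t)) := by
  have hcomm : ∀ z z' : E, g₁ z (transfer g₀ g₁ z') = g₁ z' (transfer g₀ g₁ z) := fun z z' => by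
    rw [← apply_transfer h₀ g₁ z, h₀.1, apply_transfer h₀]
  have hmix : ∀ z z' : E, g₀ z (transfer g₀ g₁ z') = g₁ z' z := fun z z' => by
    rw [h₀.1, apply_transfer h₀]
  refine ⟨fun x y => ?_, fun x hx => ?_⟩
  · obtain ⟨z, rfl⟩ := exists_cayley_denominator_eq h₀ h₁ ht x
    obtain ⟨z', rfl⟩ := exists_cayley_denominator_eq h₀ h₁ ht y
    rw [cayley_apply_denominator σ h₀ h₁ ht, cayley_apply_denominator σ h₀ h₁ ht]
    simp only [map_add, map_smul, smul_eq_mul, hmix, hcomm z' z, h₀.1 z' z, h₁.1 z' z]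
  · obtain ⟨z, rfl⟩ := exists_cayley_denominator_eq h₀ h₁ ht x
    rw [cayley_apply_denominator σ h₀ h₁ ht]
    have hz : z ≠ 0 := by
      rintro rfl
      simp at hx
    have hP : 0 ≤ g₁ z (transfer g₀ g₁ z) := by
      rw [← apply_transfer h₀]
      by_cases h : transfer g₀ g₁ z = 0
      · simp [h]
      · exact (h₀.2 _ h).le
    simp only [map_add, map_smul, smul_eq_mul, hmix]
    have e0 := h₀.2 z hz
    have e1 := h₁.2 z hz
    have ht' : 0 ≤ (1 + t) * (1 - t) := mul_nonneg (by linarith [ht.1]) (by linarith [ht.2])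
    have : 0 < ((1 + t) * (1 + t) + (1 - t) * (1 - t)) * g₁ z z :=
      mul_pos (by nlinarith [ht.1]) e1
    nlinarith [mul_nonneg ht' hP, mul_nonneg ht' e0.le]

/-- Conjugation by `J₀` inverts `P`, and the Cayley fraction `R` satisfies `R(P⁻¹) = R(P)⁻¹`. Hence
`R J₀ R = J₀`, and `J₀ R` is the complex structure of the new product. -/
theorem isCompat_cayley {σ : Fin 1 → Bil E} (h₀ : IsCompat n σ g₀) (h₁ : IsCompat n σ g₁)
    (ht : t ∈ Set.Icc (0 : ℝ) 1) : IsCompat n σ (cayley (σ, g₀, g₁, t)) := by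
  obtain ⟨J₀, hJ₀, hJJ₀⟩ := h₀.exists_complexStructure
  obtain ⟨J₁, hJ₁, hJJ₁⟩ := h₁.exists_complexStructure
  have p₀ := h₀.isPos
  have p₁ := h₁.isPos
  obtain ⟨b, hb, -⟩ := h₀
  set P := transfer g₀ g₁ with hP
  have hPJ₁ : ∀ x, P (J₁ x) = J₀ x := fun x => p₀.ext fun y => by
    rw [apply_transfer p₀, hJ₁, hJ₀]
  have hJP : ∀ x, J₀ (P x) = J₁ x := fun x => by
    have h := hPJ₁ (J₁ x)
    rw [hJJ₁, map_neg] at h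
    rw [show P x = -J₀ (J₁ x) by rw [← h, neg_neg], map_neg, hJJ₀, neg_neg]
  have hPinj : ∀ {x y}, P x = P y → x = y := fun {x y} h => p₁.ext fun z => by
    rw [← apply_transfer p₀, ← apply_transfer p₀ g₁, ← hP, h]
  have pt := isPos_cayley (σ := σ) p₀ p₁ ht
  set R := transfer g₀ (cayley (σ, g₀, g₁, t)) with hR
  have hRQ : ∀ z, R ((1 - t) • P z + (1 + t) • z) = (1 + t) • P z + (1 - t) • z :=
    fun z => p₀.ext fun y => by
      rw [apply_transfer p₀, cayley_apply_denominator σ p₀ p₁ ht]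
      simp [hP, apply_transfer p₀]
  have hRP : ∀ x, R (P x) = P (R x) := fun x => by
    obtain ⟨z, rfl⟩ := exists_cayley_denominator_eq p₀ p₁ ht x
    rw [← hP, hRQ]
    have := hRQ (P z)
    simpa only [map_add, map_smul] using this
  have hRJR : ∀ x, R (J₀ (R x)) = J₀ x := fun x => by
    obtain ⟨z, rfl⟩ := exists_cayley_denominator_eq p₀ p₁ ht x
    rw [← hP, hRQ]
    -- After applying `P`, which commutes with `R`, the left side becomes `R` of the denominator
    -- evaluated at `J₀ z`, so `hRQ` applies once more.
    refine hPinj ?_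
    rw [← hRP]
    have h := hRQ (J₀ z)
    simp only [map_add, map_smul, hJP, hPJ₁] at h ⊢
    rw [add_comm, h, add_comm]
  have hσ : ∀ x y, σ 0 x y = -σ 0 y x := hb.skew 0
  refine isCompat_of_complexStructure (Module.finrank_eq_card_basis b) pt hσ
    (J := J₀.comp R) (fun x y => ?_) fun x => ?_
  · rw [← apply_transfer p₀, ← hR, ContinuousLinearMap.comp_apply, hRJR, hJ₀]
  · simp only [ContinuousLinearMap.comp_apply, hRJR, hJJ₀]

theorem contDiffAt_cayley (σ : Fin 1 → Bil E) (h₀ : IsPos g₀) (h₁ : IsPos g₁)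
    (ht : t ∈ Set.Icc (0 : ℝ) 1) : ContDiffAt ℝ ∞ cayley (σ, g₀, g₁, t) := by
  have hP : ContDiffAt ℝ ∞ (fun p : (Fin 1 → Bil E) × Bil E × Bil E × ℝ =>
      transfer p.2.1 p.2.2.1) (σ, g₀, g₁, t) :=
    (contDiffAt_transfer (g := g₀) (h := g₁) h₀).comp (σ, g₀, g₁, t)
      (f := fun p : (Fin 1 → Bil E) × Bil E × Bil E × ℝ => (p.2.1, p.2.2.1)) (by fun_prop)
  have hc : ContDiffAt ℝ ∞ (fun p : (Fin 1 → Bil E) × Bil E × Bil E × ℝ => p.2.2.2)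
    (σ, g₀, g₁, t) := by fun_prop
  obtain ⟨u, hu⟩ := isUnit_cayley_denominator h₀ h₁ ht
  have hQ : ContDiffAt ℝ ∞ (fun p : (Fin 1 → Bil E) × Bil E × Bil E × ℝ =>
      Ring.inverse ((1 - p.2.2.2) • transfer p.2.1 p.2.2.1 + (1 + p.2.2.2) • (1 : E →L[ℝ] E)))
      (σ, g₀, g₁, t) := by
    refine ContDiffAt.comp (σ, g₀, g₁, t) (g := Ring.inverse) ?_
      (((contDiffAt_const.sub hc).smul hP).add ((contDiffAt_const.add hc).smul contDiffAt_const))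
    rw [← hu]
    exact contDiffAt_ringInverse ℝ u
  exact ContDiffAt.clm_comp (by fun_prop)
    ((((contDiffAt_const.add hc).smul hP).add ((contDiffAt_const.sub hc).smul contDiffAt_const)).mul
      hQ)

variable (E n) in
/-- Compatible scalar products of a symplectic vector space. -/
def symplecticInterpolation : Interpolation E n 1 where
  toFun := cayley
  compat := isCompat_cayley
  zero h₀ h₁ := cayley_eq h₀.isPos h₁.isPos (by simp) fun z y => by
    simp [apply_transfer h₀.isPos]
  one h₀ h₁ := cayley_eq h₀.isPos h₁.isPos (by simp) fun z y => by
    simp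
  smooth h₀ h₁ := contDiffAt_cayley _ h₀.isPos h₁.isPos
  natural {σ} _ _ _ h₀ h₁ ht L := by
    refine (cayley_eq (h₀.pull L).isPos (h₁.pull L).isPos ht fun z y => ?_).symm
    rw [transfer_pull h₀.isPos]
    have := cayley_apply_denominator σ h₀.isPos h₁.isPos ht (L z) (L y)
    simpa using this

end Symplectic

end Polysymplectic

end

noncomputable section

namespace Polysymplectic

/-! ### Several forms: a scalar product rebuilt from its horizontal part -/

section Reconstruction

variable {E : Type*} [NormedAddCommGroup E] [NormedSpace ℝ E] [FiniteDimensional ℝ E] {n s : ℕ}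

/-- The operator `D` with `m(D x, y) = σ(x, H y)`. -/
def recOp (σ : Bil E) (H : E →L[ℝ] E) (m : Bil E) : E →L[ℝ] E :=
  transfer m (σ.bilinearComp (ContinuousLinearMap.id ℝ E) H)

/-- The scalar product with horizontal part `q` and vertical part dual to it. -/
def recForm (σ : Fin s → Bil E) (H : E →L[ℝ] E) (q m : Bil E) : Bil E :=
  q + ∑ j, pull (recOp (σ j) H m) m

variable {σ : Fin s → Bil E} {H : E →L[ℝ] E} {q m : Bil E}

theorem recForm_apply (x y : E) :
    recForm σ H q m x y = q x y + ∑ j, m (recOp (σ j) H m x) (recOp (σ j) H m y) := by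
  simp [recForm]

/-- The operator `recOp (σ j) H m` kills the horizontal `v_i` by isotropy, sends `w^j_i` to `-v_i`
and kills the other `w^l_i`. Each block of `w^j_i` thus inherits the orthonormality of the `v_i`,
and different blocks become orthogonal. -/
theorem recForm_family (hm : IsPos m) (hskew : ∀ j x y, σ j x y = - σ j y x)
    (iso : ∀ j x y, σ j (H x) (H y) = 0) (hqH : ∀ x y, q x (H y) = q x y)
    (hqs : ∀ x y, q x y = q y x)
    {v : Fin n → E} {w : Fin s → Fin n → E} (hv : ∀ i, H (v i) = v i) (hw : ∀ j i, H (w j i) = 0)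
    (hmv : ∀ i y, m (v i) y = q (v i) y) (hq : ∀ j i y, σ j y (w j i) = q (v i) y)
    (hperp : ∀ j l i y, l ≠ j → σ j y (w l i) = 0)
    (hvv : ∀ i k, q (v i) (v k) = if i = k then 1 else 0) :
    (∀ i k, recForm σ H q m (v i) (v k) = if i = k then 1 else 0) ∧
    (∀ i l k, recForm σ H q m (v i) (w l k) = 0) ∧
    (∀ i l k, recForm σ H q m (w l k) (v i) = 0) ∧
    ∀ l i l' k, recForm σ H q m (w l i) (w l' k) = if l = l' ∧ i = k then 1 else 0 := by
  have hDv : ∀ j i, recOp (σ j) H m (v i) = 0 := fun j i => hm.ext fun y => by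
    rw [recOp, apply_transfer hm, ContinuousLinearMap.bilinearComp_apply,
      ContinuousLinearMap.id_apply, ← hv i, iso]
    simp
  have hDw : ∀ j l i, recOp (σ j) H m (w l i) = if l = j then -v i else 0 := fun j l i =>
    hm.ext fun y => by
      rw [recOp, apply_transfer hm, ContinuousLinearMap.bilinearComp_apply,
        ContinuousLinearMap.id_apply, hskew]
      split_ifs with h
      · subst h
        rw [hq, hqH, map_neg, neg_apply, hmv]
      · rw [hperp _ _ _ _ h]
        simp
  have hqw : ∀ l i y, q y (w l i) = 0 := fun l i y => by rw [← hqH, hw, map_zero]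
  refine ⟨fun i k => ?_, fun i l k => ?_, fun i l k => ?_, fun l i l' k => ?_⟩
  · simp [recForm_apply, hDv, hvv]
  · simp [recForm_apply, hDv, hqw]
  · simp [recForm_apply, hDv, hqs _ (v i), hqw]
  · simp only [recForm_apply, hDw, hqw, zero_add]
    rw [Finset.sum_eq_single l]
    · by_cases h : l' = l
      · subst h
        simp [hmv, hvv]
      · simp [h, Ne.symm h]
    · intro j _ hj
      simp [Ne.symm hj]
    · simp

/-- Identifies the endpoints of the path: a given orthonormal standard basis stays orthonormal for
the rebuilt form, and that determines the form. -/
theorem isOrthonormalBasis_recForm (hm : IsPos m) (iso : ∀ j x y, σ j (H x) (H y) = 0)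
    (hqH : ∀ x y, q x (H y) = q x y) (hqs : ∀ x y, q x y = q y x)
    {b : Module.Basis (Fin n ⊕ Fin s × Fin n) ℝ E} (hb : IsStd σ b)
    (hv : ∀ i, H (b (Sum.inl i)) = b (Sum.inl i)) (hw : ∀ p, H (b (Sum.inr p)) = 0)
    (hmv : ∀ i y, m (b (Sum.inl i)) y = q (b (Sum.inl i)) y)
    (hvv : ∀ i k, q (b (Sum.inl i)) (b (Sum.inl k)) = if i = k then 1 else 0) :
    IsOrthonormalBasis (recForm σ H q m) b := by
  have hqc : ∀ i y, b.coord (Sum.inl i) y = q (b (Sum.inl i)) y := by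
    intro i y
    suffices h : b.coord (Sum.inl i) = (q (b (Sum.inl i)) : E →ₗ[ℝ] ℝ) from
      DFunLike.congr_fun h y
    refine b.ext ?_
    rintro (k | p)
    · simp [hvv, Finsupp.single_apply, eq_comm]
    · simp [← hqH _ (b (Sum.inr p)), hw]
  obtain ⟨h1, h2, h3, h4⟩ := recForm_family (v := fun i => b (Sum.inl i))
    (w := fun j i => b (Sum.inr (j, i))) hm hb.skew iso hqH hqs hv (fun j i => hw _) hmv
    (fun j i y => by rw [hb.apply_inr, if_pos rfl, hqc])
    (fun j l i y h => by rw [hb.apply_inr, if_neg h]) hvv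
  refine ⟨?_, ?_⟩
  · rintro (i | ⟨l, i⟩)
    · simp [h1]
    · simp [h4]
  · rintro (i | ⟨l, i⟩) (k | ⟨l', k⟩) h
    · rw [h1, if_neg (by simpa using h)]
    · exact h2 _ _ _
    · exact h3 _ _ _
    · rw [h4, if_neg (by simpa using h)]

theorem exists_orthonormal_family {V : Type*} [AddCommGroup V] [Module ℝ V] [FiniteDimensional ℝ V]
    (hn : Module.finrank ℝ V = n) (B : LinearMap.BilinForm ℝ V) (hB : ∀ x y, B x y = B y x)
    (hpos : ∀ x, x ≠ 0 → 0 < B x x) :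
    ∃ v : Fin n → V, ∀ i j, B (v i) (v j) = if i = j then 1 else 0 := by
  subst hn
  obtain ⟨v, hv⟩ := LinearMap.BilinForm.exists_orthogonal_basis (B := B) ⟨hB⟩
  refine ⟨fun i => (Real.sqrt (B (v i) (v i)))⁻¹ • v i, fun i j => ?_⟩
  have hp := hpos (v i) (v.ne_zero i)
  split_ifs with h
  · subst h
    simp only [map_smul, LinearMap.smul_apply, smul_eq_mul]
    rw [← mul_assoc, ← mul_inv, Real.mul_self_sqrt hp.le, inv_mul_cancel₀ hp.ne']
  · have : B (v i) (v j) = 0 := hv h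
    simp [this]

/-- Reconstruction of a compatible scalar product from a horizontal projection `H` and a scalar
product `q` on the horizontal space. -/
theorem isCompat_recForm {b : Module.Basis (Fin n ⊕ Fin s × Fin n) ℝ E} (hb : IsStd σ b)
    (hm : IsPos m) (iso : ∀ j x y, σ j (H x) (H y) = 0) (hqH : ∀ x y, q x (H y) = q x y)
    (hqs : ∀ x y, q x y = q y x) (hHH : ∀ x, H (H x) = H x) (hw : ∀ p, H (b (Sum.inr p)) = 0)
    (hmH : ∀ x y, m (H x) y = q (H x) y)
    (hqpos : ∀ x, (∃ i, b.coord (Sum.inl i) x ≠ 0) → 0 < q x x) :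
    IsCompat n σ (recForm σ H q m) := by
  classical
  have hqw : ∀ y p, q y (b (Sum.inr p)) = 0 := fun y p => by rw [← hqH, hw, map_zero]
  -- `q` is degenerate on `E` but definite on the span of the `v_i` of `b`. A `q`-orthonormal family
  -- there, moved by `H`, gives the new `v_i`.
  let ι : (Fin n → ℝ) →ₗ[ℝ] E := Fintype.linearCombination ℝ fun i => b (Sum.inl i)
  have hι : ∀ c i, b.coord (Sum.inl i) (ι c) = c i := fun c i => by
    simp [ι, Fintype.linearCombination_apply, Finsupp.single_apply]
  obtain ⟨u, hu⟩ := exists_orthonormal_family (n := n) (by simp)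
    (LinearMap.BilinForm.comp (ContinuousLinearMap.toLinearMap₁₂ q) ι ι) (fun x y => hqs _ _)
    fun c hc => by
      obtain ⟨i, hi⟩ := Function.ne_iff.1 hc
      exact hqpos _ ⟨i, by simpa [hι] using hi⟩
  have hqH' : ∀ x y, q (H x) y = q x y := fun x y => by rw [hqs, hqH, hqs]
  have hvv : ∀ i k, q (H (ι (u i))) (H (ι (u k))) = if i = k then 1 else 0 := fun i k => by
    rw [hqH, hqH', ← hu i k]
    rfl
  -- These sums are the new `w^j_i`: the combinations of the old `w^j_k` that represent `q(v_i, ·)`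
  -- through `σ j`.
  have hH : ∀ (j : Fin s) (i : Fin n), H (∑ k, q (H (ι (u i))) (b (Sum.inl k)) •
      b (Sum.inr (j, k))) = 0 := fun j i => by simp [hw]
  have hqsum : ∀ x y, q x y = ∑ k, q x (b (Sum.inl k)) * b.coord (Sum.inl k) y := fun x y => by
    conv_lhs => rw [← b.sum_repr y, Fintype.sum_sum_type]
    simp only [map_add, map_sum, map_smul, hqw, mul_zero, Finset.sum_const_zero,
      add_zero, smul_eq_mul, b.coord_apply]
    exact Finset.sum_congr rfl fun _ _ => mul_comm _ _
  have hq : ∀ (j : Fin s) (i : Fin n) (y : E), σ j y (∑ k, q (H (ι (u i))) (b (Sum.inl k)) •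
      b (Sum.inr (j, k))) = q (H (ι (u i))) y := fun j i y => by
    rw [hqsum _ y]
    simp [hb.apply_inr]
  have hperp : ∀ (j l : Fin s) (i : Fin n) (y : E), l ≠ j →
      σ j y (∑ k, q (H (ι (u i))) (b (Sum.inl k)) • b (Sum.inr (l, k))) = 0 :=
    fun j l i y h => by simp [hb.apply_inr, h]
  obtain ⟨h1, h2, h3, h4⟩ := recForm_family (σ := σ) (v := fun i => H (ι (u i)))
    (w := fun j i => ∑ k, q (H (ι (u i))) (b (Sum.inl k)) • b (Sum.inr (j, k))) hm hb.skew iso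
    hqH hqs (fun i => hHH _) hH (fun i y => hmH _ _) hq hperp hvv
  refine isCompat_of_family (Module.finrank_eq_card_basis b) hb.skew _ _ (fun j i k => iso _ _ _)
    (fun j i l k => ?_) (fun j l i m k => ?_) h1 h2 h3 h4
  · by_cases h : l = j
    · subst h
      rw [hq, hvv]
      simp
    · rw [hperp _ _ _ _ h, if_neg (fun h' => h h'.1)]
  · by_cases h : m = j
    · subst h
      rw [hq, ← hqH, hH, map_zero]
    · rw [hperp _ _ _ _ h]

end Reconstruction

/-! ### Several forms: the horizontal projection and the path -/

section Horizontal

variable {E : Type*} [NormedAddCommGroup E] [NormedSpace ℝ E] [FiniteDimensional ℝ E] {n s : ℕ}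
  {σ : Fin s → Bil E} {g : Bil E} {b b' : Module.Basis (Fin n ⊕ Fin s × Fin n) ℝ E} {i j : Fin s}

/-- The projection to the span of the `v_i` along the span of the `w^j_i`. -/
def horProj (σ₁ σ₂ g : Bil E) : E →L[ℝ] E :=
  transfer g σ₁ * transfer g σ₁ * (transfer g σ₂ * transfer g σ₂)

theorem transfer_inl (hb : IsStd σ b) (hg : IsOrthonormalBasis g b) (j : Fin s) (k : Fin n) :
    transfer g (σ j) (b (Sum.inl k)) = b (Sum.inr (j, k)) :=
  hg.isPos.ext fun y => by
    rw [apply_transfer hg.isPos, hb.apply_inl, hg.isPos.1, isOrthonormalBasis_apply hg]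

theorem transfer_inr (hb : IsStd σ b) (hg : IsOrthonormalBasis g b) (j l : Fin s) (k : Fin n) :
    transfer g (σ j) (b (Sum.inr (l, k))) = if l = j then -b (Sum.inl k) else 0 :=
  hg.isPos.ext fun y => by
    rw [apply_transfer hg.isPos, hb.skew, hb.apply_inr]
    split_ifs
    · rw [map_neg, neg_apply, hg.isPos.1, isOrthonormalBasis_apply hg]
    · simp

/-- The square of `transfer g (σ j)` is minus the projection to the span of the `v_k` and `w^j_k`.
For `i ≠ j` the product of two such squares is the projection to the common part, the span of the
`v_k`, and the signs cancel. -/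
theorem horProj_inl (hb : IsStd σ b) (hg : IsOrthonormalBasis g b) (k : Fin n) :
    horProj (σ i) (σ j) g (b (Sum.inl k)) = b (Sum.inl k) := by
  simp [horProj, transfer_inl hb hg, transfer_inr hb hg]

theorem horProj_inr (hb : IsStd σ b) (hg : IsOrthonormalBasis g b) (hij : i ≠ j)
    (p : Fin s × Fin n) : horProj (σ i) (σ j) g (b (Sum.inr p)) = 0 := by
  obtain ⟨l, k⟩ := p
  by_cases h : l = j
  · subst h
    simp [horProj, transfer_inl hb hg, transfer_inr hb hg, hij.symm]
  · simp [horProj, transfer_inr hb hg, h]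

/-- The vector `x` is in the span of the `w^j_i`. -/
def IsVert (b : Module.Basis (Fin n ⊕ Fin s × Fin n) ℝ E) (x : E) : Prop :=
  ∀ k, b.coord (Sum.inl k) x = 0

theorem IsVert.eq_sum {x : E} (h : IsVert b x) : x = ∑ p, b.coord (Sum.inr p) x • b (Sum.inr p) := by
  conv_lhs => rw [← b.sum_repr x]
  rw [Fintype.sum_sum_type, Finset.sum_eq_zero, zero_add]
  · rfl
  · intro k _
    rw [show b.repr x (Sum.inl k) = 0 from h k, zero_smul]

/-- A vector `w^p` is annihilated by every `σ l` with `l ≠ p`. The coordinate of such a vector along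
any `v_k'` is its pairing with `w'^l_k` under `σ l`, hence zero. Two distinct indices ensure that
such an `l` exists. -/
theorem IsVert.of_isStd (hij : i ≠ j) (hb : IsStd σ b) (hb' : IsStd σ b') {x : E}
    (h : IsVert b x) : IsVert b' x := by
  intro k
  rw [h.eq_sum, map_sum]
  refine Finset.sum_eq_zero fun p _ => ?_
  obtain ⟨l, hl⟩ : ∃ l, p.1 ≠ l := by
    by_cases h : p.1 = i
    · exact ⟨j, h ▸ hij⟩
    · exact ⟨i, h⟩
  have h0 : b'.coord (Sum.inl k) (b (Sum.inr p)) = σ l (b (Sum.inr p)) (b' (Sum.inr (l, k))) := by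
    rw [hb'.apply_inr, if_pos rfl]
  rw [map_smul, h0, hb.skew, hb.apply_inr, if_neg hl, neg_zero, smul_zero]

theorem IsVert.apply_eq_zero (hb : IsStd σ b) {x y : E} (hx : IsVert b x) (hy : IsVert b y)
    (l : Fin s) : σ l x y = 0 := by
  rw [hb]
  exact Finset.sum_eq_zero fun k _ => by simp [wedge, hx k, hy k]

theorem IsVert.horProj_eq_zero (hb : IsStd σ b) (hg : IsOrthonormalBasis g b) (hij : i ≠ j)
    {x : E} (h : IsVert b x) : horProj (σ i) (σ j) g x = 0 := by
  rw [h.eq_sum, map_sum]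
  exact Finset.sum_eq_zero fun p _ => by rw [map_smul, horProj_inr hb hg hij, smul_zero]

theorem horProj_eq_sum (hb : IsStd σ b) (hg : IsOrthonormalBasis g b) (hij : i ≠ j) (x : E) :
    horProj (σ i) (σ j) g x = ∑ k, b.coord (Sum.inl k) x • b (Sum.inl k) := by
  conv_lhs => rw [← b.sum_repr x, Fintype.sum_sum_type]
  simp only [map_add, map_sum, map_smul, horProj_inr hb hg hij, horProj_inl hb hg,
    smul_zero, Finset.sum_const_zero, add_zero, b.coord_apply]

theorem isVert_sub_horProj (hb : IsStd σ b) (hg : IsOrthonormalBasis g b) (hij : i ≠ j) (x : E) :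
    IsVert b (x - horProj (σ i) (σ j) g x) := by
  intro k
  rw [horProj_eq_sum hb hg hij]
  simp [Finsupp.single_apply]

theorem apply_horProj_horProj (hb : IsStd σ b) (hg : IsOrthonormalBasis g b) (hij : i ≠ j) (x y : E)
    (l : Fin s) : σ l (horProj (σ i) (σ j) g x) (horProj (σ i) (σ j) g y) = 0 := by
  rw [hb]
  refine Finset.sum_eq_zero fun k _ => ?_
  rw [horProj_eq_sum hb hg hij, horProj_eq_sum hb hg hij]
  simp [wedge]

/-- The interpolation of the horizontal projections. -/
def horPath (i j : Fin s) (p : (Fin s → Bil E) × Bil E × Bil E × ℝ) : E →L[ℝ] E :=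
  (1 - p.2.2.2) • horProj (p.1 i) (p.1 j) p.2.1 + p.2.2.2 • horProj (p.1 i) (p.1 j) p.2.2.1

/-- The interpolation of the horizontal scalar products. -/
def horFormPath (i j : Fin s) (p : (Fin s → Bil E) × Bil E × Bil E × ℝ) : Bil E :=
  (1 - p.2.2.2) • pull (horProj (p.1 i) (p.1 j) p.2.1) p.2.1 +
    p.2.2.2 • pull (horProj (p.1 i) (p.1 j) p.2.2.1) p.2.2.1

/-- A scalar product extending the interpolation of the horizontal ones. -/
def horExtPath (i j : Fin s) (p : (Fin s → Bil E) × Bil E × Bil E × ℝ) : Bil E :=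
  horFormPath i j p + pull (1 - horPath i j p) p.2.1

/-- The interpolation of compatible scalar products. -/
def polyPath (i j : Fin s) (p : (Fin s → Bil E) × Bil E × Bil E × ℝ) : Bil E :=
  recForm p.1 (horPath i j p) (horFormPath i j p) (horExtPath i j p)

variable {g₀ g₁ : Bil E} {b₀ b₁ : Module.Basis (Fin n ⊕ Fin s × Fin n) ℝ E} {t : ℝ}

theorem horPath_apply (x : E) : horPath i j (σ, g₀, g₁, t) x =
    (1 - t) • horProj (σ i) (σ j) g₀ x + t • horProj (σ i) (σ j) g₁ x := rfl

theorem horFormPath_apply (x y : E) : horFormPath i j (σ, g₀, g₁, t) x y =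
    (1 - t) * g₀ (horProj (σ i) (σ j) g₀ x) (horProj (σ i) (σ j) g₀ y) +
      t * g₁ (horProj (σ i) (σ j) g₁ x) (horProj (σ i) (σ j) g₁ y) := rfl

theorem horExtPath_apply (x y : E) : horExtPath i j (σ, g₀, g₁, t) x y =
    horFormPath i j (σ, g₀, g₁, t) x y +
      g₀ (x - horPath i j (σ, g₀, g₁, t) x) (y - horPath i j (σ, g₀, g₁, t) y) := rfl

section

variable (hij : i ≠ j) (hb₀ : IsStd σ b₀) (hg₀ : IsOrthonormalBasis g₀ b₀)
  (hb₁ : IsStd σ b₁) (hg₁ : IsOrthonormalBasis g₁ b₁)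
include hij hb₀ hg₀ hb₁ hg₁

theorem isVert_sub_horPath (x : E) : IsVert b₀ (x - horPath i j (σ, g₀, g₁, t) x) := by
  have h0 := isVert_sub_horProj hb₀ hg₀ hij x
  have h1 := (isVert_sub_horProj hb₁ hg₁ hij x).of_isStd hij hb₁ hb₀
  intro k
  have : x - horPath i j (σ, g₀, g₁, t) x = (1 - t) • (x - horProj (σ i) (σ j) g₀ x) +
      t • (x - horProj (σ i) (σ j) g₁ x) := by
    rw [horPath_apply]
    module
  rw [this, map_add, map_smul, map_smul, h0 k, h1 k]
  simp

theorem IsVert.horPath_eq_zero {x : E} (h : IsVert b₀ x) : horPath i j (σ, g₀, g₁, t) x = 0 := by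
  rw [horPath_apply, h.horProj_eq_zero hb₀ hg₀ hij,
    (h.of_isStd hij hb₀ hb₁).horProj_eq_zero hb₁ hg₁ hij]
  simp

theorem horPath_horPath (x : E) : horPath i j (σ, g₀, g₁, t) (horPath i j (σ, g₀, g₁, t) x) =
    horPath i j (σ, g₀, g₁, t) x := by
  have h := (isVert_sub_horPath (t := t) hij hb₀ hg₀ hb₁ hg₁ x).horPath_eq_zero (t := t) hij hb₀ hg₀
    hb₁ hg₁
  rw [map_sub, sub_eq_zero] at h
  exact h.symm

/-- The difference of the two projections takes vertical values, and `σ l` vanishes on vertical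
pairs. The expression is therefore affine in `t`, and it vanishes at both ends. -/
theorem apply_horPath_horPath (l : Fin s) (x y : E) :
    σ l (horPath i j (σ, g₀, g₁, t) x) (horPath i j (σ, g₀, g₁, t) y) = 0 := by
  set P := horProj (σ i) (σ j) g₀ with hP
  set Q := horProj (σ i) (σ j) g₁ with hQ
  have hvert : ∀ x, IsVert b₀ (Q x - P x) := fun x k => by
    have h0 := isVert_sub_horProj hb₀ hg₀ hij x k
    have h1 := (isVert_sub_horProj hb₁ hg₁ hij x).of_isStd hij hb₁ hb₀ k
    rw [← hP, map_sub, sub_eq_zero] at h0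
    rw [← hQ, map_sub, sub_eq_zero] at h1
    rw [map_sub, ← h0, ← h1, sub_self]
  have hpath : ∀ x, horPath i j (σ, g₀, g₁, t) x = P x + t • (Q x - P x) := fun x => by
    rw [horPath_apply]
    module
  have e0 : σ l (P x) (P y) = 0 := apply_horProj_horProj hb₀ hg₀ hij x y l
  have e1 : σ l (Q x) (Q y) = 0 := apply_horProj_horProj hb₁ hg₁ hij x y l
  have e2 := (hvert x).apply_eq_zero hb₀ (hvert y) l
  rw [hpath, hpath]
  simp only [map_add, map_sub, map_smul, add_apply, sub_apply, smul_apply, smul_eq_mul] at e2 ⊢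
  linear_combination (1 - t) * e0 + t * e1 - (t - t ^ 2) * e2

theorem horFormPath_horPath (x y : E) : horFormPath i j (σ, g₀, g₁, t) x
    (horPath i j (σ, g₀, g₁, t) y) = horFormPath i j (σ, g₀, g₁, t) x y := by
  have hv := isVert_sub_horPath (t := t) hij hb₀ hg₀ hb₁ hg₁ y
  have h0 := hv.horProj_eq_zero hb₀ hg₀ hij
  have h1 := (hv.of_isStd hij hb₀ hb₁).horProj_eq_zero hb₁ hg₁ hij
  rw [map_sub, sub_eq_zero] at h0 h1
  rw [horFormPath_apply, horFormPath_apply, ← h0, ← h1]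

theorem horFormPath_symm (x y : E) : horFormPath i j (σ, g₀, g₁, t) x y =
    horFormPath i j (σ, g₀, g₁, t) y x := by
  rw [horFormPath_apply, horFormPath_apply, hg₀.isPos.1, hg₁.isPos.1]

theorem horFormPath_pos (ht : t ∈ Set.Icc (0 : ℝ) 1) {x : E} (hx : ¬ IsVert b₀ x) :
    0 < horFormPath i j (σ, g₀, g₁, t) x x := by
  have h0 : horProj (σ i) (σ j) g₀ x ≠ 0 := fun h => hx <| by
    simpa [h] using isVert_sub_horProj hb₀ hg₀ hij x
  have h1 : horProj (σ i) (σ j) g₁ x ≠ 0 := fun h => hx <| by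
    simpa [h] using (isVert_sub_horProj hb₁ hg₁ hij x).of_isStd hij hb₁ hb₀
  have p0 := hg₀.isPos.2 _ h0
  have p1 := hg₁.isPos.2 _ h1
  rw [horFormPath_apply]
  rcases ht.2.lt_or_eq with h | rfl
  · have := mul_pos (sub_pos.2 h) p0
    have := mul_nonneg ht.1 p1.le
    linarith
  · simpa using p1

/-- Off the vertical space the horizontal part is already positive. On it, that part vanishes and
`horPath` is zero, so `g₀` remains. -/
theorem isPos_horExtPath (ht : t ∈ Set.Icc (0 : ℝ) 1) : IsPos (horExtPath i j (σ, g₀, g₁, t)) := by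
  refine ⟨fun x y => ?_, fun x hx => ?_⟩
  · rw [horExtPath_apply, horExtPath_apply, hg₀.isPos.1, horFormPath_symm hij hb₀ hg₀ hb₁ hg₁]
  · rw [horExtPath_apply]
    by_cases hv : IsVert b₀ x
    · rw [hv.horPath_eq_zero hij hb₀ hg₀ hb₁ hg₁, sub_zero, horFormPath_apply,
        hv.horProj_eq_zero hb₀ hg₀ hij,
        (hv.of_isStd hij hb₀ hb₁).horProj_eq_zero hb₁ hg₁ hij]
      simpa using hg₀.isPos.2 x hx
    · refine add_pos_of_pos_of_nonneg (horFormPath_pos hij hb₀ hg₀ hb₁ hg₁ ht hv) ?_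
      by_cases h : x - horPath i j (σ, g₀, g₁, t) x = 0
      · simp [h]
      · exact (hg₀.isPos.2 _ h).le

theorem horExtPath_horPath (x y : E) : horExtPath i j (σ, g₀, g₁, t)
    (horPath i j (σ, g₀, g₁, t) x) y =
    horFormPath i j (σ, g₀, g₁, t) (horPath i j (σ, g₀, g₁, t) x) y := by
  rw [horExtPath_apply, horPath_horPath hij hb₀ hg₀ hb₁ hg₁]
  simp

theorem isCompat_polyPath (ht : t ∈ Set.Icc (0 : ℝ) 1) :
    IsCompat n σ (polyPath i j (σ, g₀, g₁, t)) := by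
  refine isCompat_recForm hb₀ (isPos_horExtPath hij hb₀ hg₀ hb₁ hg₁ ht)
    (apply_horPath_horPath hij hb₀ hg₀ hb₁ hg₁) (horFormPath_horPath hij hb₀ hg₀ hb₁ hg₁)
    (horFormPath_symm hij hb₀ hg₀ hb₁ hg₁) (horPath_horPath hij hb₀ hg₀ hb₁ hg₁) (fun p => ?_)
    (horExtPath_horPath hij hb₀ hg₀ hb₁ hg₁) fun x hx =>
      horFormPath_pos hij hb₀ hg₀ hb₁ hg₁ ht fun h => ?_
  · refine IsVert.horPath_eq_zero hij hb₀ hg₀ hb₁ hg₁ fun k => ?_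
    simp
  · obtain ⟨k, hk⟩ := hx
    exact hk (h k)

theorem isOrthonormalBasis_polyPath (ht : t ∈ Set.Icc (0 : ℝ) 1)
    {b : Module.Basis (Fin n ⊕ Fin s × Fin n) ℝ E} (hb : IsStd σ b)
    (hv : ∀ k, horPath i j (σ, g₀, g₁, t) (b (Sum.inl k)) = b (Sum.inl k))
    (hvv : ∀ k l, horFormPath i j (σ, g₀, g₁, t) (b (Sum.inl k)) (b (Sum.inl l)) =
      if k = l then 1 else 0) :
    IsOrthonormalBasis (polyPath i j (σ, g₀, g₁, t)) b := by
  refine isOrthonormalBasis_recForm (isPos_horExtPath hij hb₀ hg₀ hb₁ hg₁ ht)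
    (apply_horPath_horPath hij hb₀ hg₀ hb₁ hg₁) (horFormPath_horPath hij hb₀ hg₀ hb₁ hg₁)
    (horFormPath_symm hij hb₀ hg₀ hb₁ hg₁) hb hv (fun p => ?_) (fun k y => ?_) hvv
  · refine IsVert.horPath_eq_zero hij hb₀ hg₀ hb₁ hg₁ (IsVert.of_isStd hij hb hb₀ fun k => ?_)
    simp
  · rw [← hv k]
    exact horExtPath_horPath hij hb₀ hg₀ hb₁ hg₁ _ _

theorem polyPath_zero : polyPath i j (σ, g₀, g₁, 0) = g₀ :=
  (isOrthonormalBasis_polyPath hij hb₀ hg₀ hb₁ hg₁ (by simp) hb₀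
    (fun k => by simp [horPath_apply, horProj_inl hb₀ hg₀])
    (fun k l => by
      simp only [horFormPath_apply, horProj_inl hb₀ hg₀]
      split_ifs with h
      · simp [h, hg₀.1]
      · simp [hg₀.2 _ _ (fun h' => h (Sum.inl_injective h'))])).eq hg₀

theorem polyPath_one : polyPath i j (σ, g₀, g₁, 1) = g₁ :=
  (isOrthonormalBasis_polyPath hij hb₀ hg₀ hb₁ hg₁ (by simp) hb₁
    (fun k => by simp [horPath_apply, horProj_inl hb₁ hg₁])
    (fun k l => by
      simp only [horFormPath_apply, horProj_inl hb₁ hg₁]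
      split_ifs with h
      · simp [h, hg₁.1]
      · simp [hg₁.2 _ _ (fun h' => h (Sum.inl_injective h'))])).eq hg₁

end

end Horizontal

end Polysymplectic

end

noncomputable section

namespace Polysymplectic

/-! ### Smoothness and naturality of the path for several forms -/

section Smoothness

variable {E : Type*} [NormedAddCommGroup E] [NormedSpace ℝ E] [FiniteDimensional ℝ E] {n s : ℕ}
  {X : Type*} [NormedAddCommGroup X] [NormedSpace ℝ X] {x : X}

theorem contDiffAt_clm_smul {F G : Type*} [NormedAddCommGroup F] [NormedSpace ℝ F]
    [NormedAddCommGroup G] [NormedSpace ℝ G] {c : X → ℝ} {f : X → F →L[ℝ] G}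
    (hc : ContDiffAt ℝ ∞ c x) (hf : ContDiffAt ℝ ∞ f x) : ContDiffAt ℝ ∞ (fun x => c x • f x) x :=
  hc.smul hf

theorem contDiffAt_clm_iff_apply {F G : Type*} [NormedAddCommGroup F] [NormedSpace ℝ F]
    [FiniteDimensional ℝ F] [NormedAddCommGroup G] [NormedSpace ℝ G] {f : X → F →L[ℝ] G} :
    ContDiffAt ℝ ∞ f x ↔ ∀ y, ContDiffAt ℝ ∞ (fun x => f x y) x := by
  refine ⟨fun h y => h.clm_apply contDiffAt_const, fun h => ?_⟩
  let d := Module.finrank ℝ F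
  have hd : d = Module.finrank ℝ (Fin d → ℝ) := (Module.finrank_fin_fun ℝ).symm
  let e₁ := ContinuousLinearEquiv.ofFinrankEq hd
  let e₂ := (e₁.arrowCongr (1 : G ≃L[ℝ] G)).trans (ContinuousLinearEquiv.piRing (Fin d))
  rw [← Function.id_comp f, ← e₂.symm_comp_self]
  exact e₂.symm.contDiff.contDiffAt.comp x (contDiffAt_pi.mpr fun i => h _)

theorem contDiffAt_bil_iff_apply {f : X → Bil E} :
    ContDiffAt ℝ ∞ f x ↔ ∀ u v, ContDiffAt ℝ ∞ (fun x => f x u v) x :=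
  contDiffAt_clm_iff_apply.trans (forall_congr' fun _ => contDiffAt_clm_iff_apply)

theorem contDiffAt_bilinearComp {f : X → Bil E} {A B : X → E →L[ℝ] E} (hf : ContDiffAt ℝ ∞ f x)
    (hA : ContDiffAt ℝ ∞ A x) (hB : ContDiffAt ℝ ∞ B x) :
    ContDiffAt ℝ ∞ (fun x => (f x).bilinearComp (A x) (B x)) x :=
  contDiffAt_bil_iff_apply.2 fun _ _ =>
    (hf.clm_apply (hA.clm_apply contDiffAt_const)).clm_apply (hB.clm_apply contDiffAt_const)

theorem contDiffAt_pull {f : X → Bil E} {A : X → E →L[ℝ] E} (hf : ContDiffAt ℝ ∞ f x)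
    (hA : ContDiffAt ℝ ∞ A x) : ContDiffAt ℝ ∞ (fun x => pull (A x) (f x)) x :=
  contDiffAt_bilinearComp hf hA hA

theorem contDiffAt_transfer_comp {g h : X → Bil E} (hg : ContDiffAt ℝ ∞ g x)
    (hh : ContDiffAt ℝ ∞ h x) (hpos : IsPos (g x)) :
    ContDiffAt ℝ ∞ (fun x => transfer (g x) (h x)) x :=
  (contDiffAt_transfer hpos).comp x (f := fun x => (g x, h x)) (hg.prodMk hh)

theorem contDiffAt_horProj {g h h' : X → Bil E} (hg : ContDiffAt ℝ ∞ g x)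
    (hh : ContDiffAt ℝ ∞ h x) (hh' : ContDiffAt ℝ ∞ h' x) (hpos : IsPos (g x)) :
    ContDiffAt ℝ ∞ (fun x => horProj (h x) (h' x) (g x)) x := by
  have h1 := contDiffAt_transfer_comp hg hh hpos
  have h2 := contDiffAt_transfer_comp hg hh' hpos
  exact (h1.mul h1).mul (h2.mul h2)

theorem contDiffAt_polyPath {σ : Fin s → Bil E} {g₀ g₁ : Bil E} {t : ℝ} {i j : Fin s} (hij : i ≠ j)
    (h₀ : IsCompat n σ g₀) (h₁ : IsCompat n σ g₁) (ht : t ∈ Set.Icc (0 : ℝ) 1) :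
    ContDiffAt ℝ ∞ (polyPath i j) (σ, g₀, g₁, t) := by
  have p₀ := h₀.isPos
  have p₁ := h₁.isPos
  obtain ⟨b₀, hb₀, hg₀⟩ := h₀
  obtain ⟨b₁, hb₁, hg₁⟩ := h₁
  have cσ : ∀ l, ContDiffAt ℝ ∞ (fun p : (Fin s → Bil E) × Bil E × Bil E × ℝ => p.1 l)
    (σ, g₀, g₁, t) := fun l => by fun_prop
  have c₀ : ContDiffAt ℝ ∞ (fun p : (Fin s → Bil E) × Bil E × Bil E × ℝ => p.2.1)
    (σ, g₀, g₁, t) := by fun_prop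
  have c₁ : ContDiffAt ℝ ∞ (fun p : (Fin s → Bil E) × Bil E × Bil E × ℝ => p.2.2.1)
    (σ, g₀, g₁, t) := by fun_prop
  have ct : ContDiffAt ℝ ∞ (fun p : (Fin s → Bil E) × Bil E × Bil E × ℝ => p.2.2.2)
    (σ, g₀, g₁, t) := by fun_prop
  have cP := contDiffAt_horProj c₀ (cσ i) (cσ j) p₀
  have cQ := contDiffAt_horProj c₁ (cσ i) (cσ j) p₁
  have cH : ContDiffAt ℝ ∞ (horPath i j) (σ, g₀, g₁, t) :=
    (contDiffAt_clm_smul (contDiffAt_const.sub ct) cP).add (contDiffAt_clm_smul ct cQ)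
  have cq : ContDiffAt ℝ ∞ (horFormPath i j) (σ, g₀, g₁, t) :=
    (contDiffAt_clm_smul (contDiffAt_const.sub ct) (contDiffAt_pull c₀ cP)).add
      (contDiffAt_clm_smul ct (contDiffAt_pull c₁ cQ))
  have cm : ContDiffAt ℝ ∞ (horExtPath i j) (σ, g₀, g₁, t) :=
    cq.add (contDiffAt_pull c₀ (contDiffAt_const.sub cH))
  refine cq.add (ContDiffAt.sum fun l _ => contDiffAt_pull cm (contDiffAt_transfer_comp cm
    (contDiffAt_bilinearComp (cσ l) contDiffAt_const cH)
    (isPos_horExtPath hij hb₀ hg₀ hb₁ hg₁ ht)))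

end Smoothness

section Naturality

variable {E : Type*} [NormedAddCommGroup E] [NormedSpace ℝ E] [FiniteDimensional ℝ E] {n s : ℕ}
  (L : E ≃L[ℝ] E)

theorem horProj_pull {σ₁ σ₂ g : Bil E} (hg : IsPos g) :
    horProj (pull (L : E →L[ℝ] E) σ₁) (pull (L : E →L[ℝ] E) σ₂) (pull (L : E →L[ℝ] E) g) =
      (L.symm : E →L[ℝ] E).comp ((horProj σ₁ σ₂ g).comp (L : E →L[ℝ] E)) := by
  ext x
  simp [horProj, transfer_pull hg]

theorem recForm_pull {σ : Fin s → Bil E} {H : E →L[ℝ] E} {q m : Bil E} (hm : IsPos m) :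
    recForm (fun l => pull (L : E →L[ℝ] E) (σ l))
      ((L.symm : E →L[ℝ] E).comp (H.comp (L : E →L[ℝ] E))) (pull (L : E →L[ℝ] E) q)
      (pull (L : E →L[ℝ] E) m) = pull (L : E →L[ℝ] E) (recForm σ H q m) := by
  have h : ∀ l x, L (recOp (pull (L : E →L[ℝ] E) (σ l))
      ((L.symm : E →L[ℝ] E).comp (H.comp (L : E →L[ℝ] E))) (pull (L : E →L[ℝ] E) m) x) =
      recOp (σ l) H m (L x) := fun l x => by
    have e : (pull (L : E →L[ℝ] E) (σ l)).bilinearComp (ContinuousLinearMap.id ℝ E)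
        ((L.symm : E →L[ℝ] E).comp (H.comp (L : E →L[ℝ] E))) =
        pull (L : E →L[ℝ] E) ((σ l).bilinearComp (ContinuousLinearMap.id ℝ E) H) := by
      ext x y
      simp
    rw [recOp, e, transfer_pull hm]
    simp [recOp]
  ext x y
  simp [recForm_apply, h]

theorem polyPath_pull {σ : Fin s → Bil E} {g₀ g₁ : Bil E} {t : ℝ} {i j : Fin s} (hij : i ≠ j)
    (h₀ : IsCompat n σ g₀) (h₁ : IsCompat n σ g₁) (ht : t ∈ Set.Icc (0 : ℝ) 1) :
    pull (L : E →L[ℝ] E) (polyPath i j (σ, g₀, g₁, t)) =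
      polyPath i j (fun j => pull (L : E →L[ℝ] E) (σ j), pull (L : E →L[ℝ] E) g₀,
        pull (L : E →L[ℝ] E) g₁, t) := by
  have p₀ := h₀.isPos
  have p₁ := h₁.isPos
  obtain ⟨b₀, hb₀, hg₀⟩ := h₀
  obtain ⟨b₁, hb₁, hg₁⟩ := h₁
  have eH : horPath i j (fun j => pull (L : E →L[ℝ] E) (σ j), pull (L : E →L[ℝ] E) g₀,
      pull (L : E →L[ℝ] E) g₁, t) =
      (L.symm : E →L[ℝ] E).comp ((horPath i j (σ, g₀, g₁, t)).comp (L : E →L[ℝ] E)) := by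
    ext x
    simp [horPath_apply, horProj_pull L p₀, horProj_pull L p₁]
  have eq : horFormPath i j (fun j => pull (L : E →L[ℝ] E) (σ j), pull (L : E →L[ℝ] E) g₀,
      pull (L : E →L[ℝ] E) g₁, t) = pull (L : E →L[ℝ] E) (horFormPath i j (σ, g₀, g₁, t)) := by
    ext x y
    simp [horFormPath_apply, horProj_pull L p₀, horProj_pull L p₁]
  have em : horExtPath i j (fun j => pull (L : E →L[ℝ] E) (σ j), pull (L : E →L[ℝ] E) g₀,
      pull (L : E →L[ℝ] E) g₁, t) = pull (L : E →L[ℝ] E) (horExtPath i j (σ, g₀, g₁, t)) := by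
    ext x y
    simp [horExtPath_apply, eH, eq]
  rw [polyPath, polyPath, eH, eq, em, recForm_pull L (isPos_horExtPath hij hb₀ hg₀ hb₁ hg₁ ht)]

variable (E n) in
/-- Compatible scalar products of a polysymplectic vector space with at least two forms. -/
def polyInterpolation {i j : Fin s} (hij : i ≠ j) : Interpolation E n s where
  toFun := polyPath i j
  compat := fun ⟨_, hb₀, hg₀⟩ ⟨_, hb₁, hg₁⟩ => isCompat_polyPath hij hb₀ hg₀ hb₁ hg₁
  zero := fun ⟨_, hb₀, hg₀⟩ ⟨_, hb₁, hg₁⟩ => polyPath_zero hij hb₀ hg₀ hb₁ hg₁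
  one := fun ⟨_, hb₀, hg₀⟩ ⟨_, hb₁, hg₁⟩ => polyPath_one hij hb₀ hg₀ hb₁ hg₁
  smooth := contDiffAt_polyPath hij
  natural h₀ h₁ ht L := polyPath_pull L hij h₀ h₁ ht

variable (E n) in
theorem nonempty_interpolation (hs : 1 ≤ s) : Nonempty (Interpolation E n s) := by
  rcases hs.eq_or_lt with rfl | hs
  · exact ⟨symplecticInterpolation E n⟩
  · exact ⟨polyInterpolation E n (i := ⟨0, by omega⟩) (j := ⟨1, hs⟩) (by simp)⟩

end Naturality

end Polysymplectic

end

/-! ### Local existence for one form, by square roots -/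

noncomputable section

namespace Polysymplectic

/-- Square roots near `1` in a Banach algebra. -/
theorem exists_local_sqrt (R : Type*) [NormedRing R] [NormedAlgebra ℝ R] [CompleteSpace R] :
    ∃ (S : Set R) (r : R → R), S ∈ 𝓝 1 ∧ Set.InjOn (fun x => x * x) S ∧
      Filter.Tendsto r (𝓝 1) (𝓝 1) ∧ ∀ᶠ A in 𝓝 (1 : R), ContDiffAt ℝ ∞ r A ∧ r A * r A = A := by
  -- Regularity `ω` at a point persists nearby. Regularity `∞` at a point need not, since the
  -- neighbourhood may shrink with the order of differentiation.
  have hf : ContDiffAt ℝ ω (fun x : R => x * x) 1 := contDiffAt_id.mul contDiffAt_id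
  let e : R ≃L[ℝ] R := ContinuousLinearEquiv.smulLeft (Units.mk0 (2 : ℝ) two_ne_zero)
  have hf' : HasFDerivAt (fun x : R => x * x) (e : R →L[ℝ] R) 1 := by
    have h := (hasFDerivAt_id (𝕜 := ℝ) (1 : R)).mul' (hasFDerivAt_id (1 : R))
    refine h.congr_fderiv ?_
    ext
    simp [e, two_smul, Units.smul_def]
  have hs := hf.hasStrictFDerivAt' hf' (by simp)
  have h1 : (1 : R) * 1 = 1 := one_mul 1
  have hr := hf.to_localInverse hf' (by simp)
  have hri := hs.eventually_right_inverse
  have ht := hs.localInverse_tendsto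
  rw [h1] at hr hri ht
  refine ⟨{x | hs.localInverse _ _ _ (x * x) = x}, hs.localInverse _ _ _,
    hs.eventually_left_inverse, fun x hx y hy hxy => ?_, ht, ?_⟩
  · rw [← Set.mem_ofPred.1 hx, ← Set.mem_ofPred.1 hy]
    exact congrArg _ hxy
  · filter_upwards [hr.eventually (by simp), hri] with A h h'
    exact ⟨h.of_le le_top, h'⟩

variable {E : Type*} [NormedAddCommGroup E] [NormedSpace ℝ E] [FiniteDimensional ℝ E] {n s : ℕ}

theorem IsStd.exists_isCompat {σ : Fin s → Bil E} {b : Module.Basis (Fin n ⊕ Fin s × Fin n) ℝ E}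
    (hb : IsStd σ b) : ∃ g, IsCompat n σ g := by
  classical
  refine ⟨LinearMap.toContinuousLinearMap ((LinearMap.toContinuousLinearMap :
    (E →ₗ[ℝ] ℝ) ≃ₗ[ℝ] _).toLinearMap ∘ₗ ∑ a, (b.coord a).smulRight (b.coord a)), b, hb, ?_, ?_⟩
  · intro a
    simp [Finsupp.single_apply, -Fintype.sum_sum_type]
  · intro a c hac
    simp [Finsupp.single_apply, hac, -Fintype.sum_sum_type]

/-- Compatible scalar products for a smooth family of symplectic forms. -/
theorem exists_local_compat_one {σ : E → Fin 1 → Bil E} {y₀ : E}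
    (hσ : ∀ᶠ y in 𝓝 y₀, ContDiffAt ℝ ∞ σ y)
    (hstd : ∀ᶠ y in 𝓝 y₀, ∃ b : Module.Basis (Fin n ⊕ Fin 1 × Fin n) ℝ E, IsStd (σ y) b) :
    ∃ γ : E → Bil E, ∀ᶠ y in 𝓝 y₀, ContDiffAt ℝ ∞ γ y ∧ IsCompat n (σ y) (γ y) := by
  have : CompleteSpace E := FiniteDimensional.complete ℝ E
  have hnd : ∀ {σ : Fin 1 → Bil E} {b : Module.Basis (Fin n ⊕ Fin 1 × Fin n) ℝ E}, IsStd σ b →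
      ∀ x, σ 0 x = 0 → x = 0 := fun {σ b} hb x hx => by
    refine b.forall_coord_eq_zero_iff.1 ?_
    rintro (i | ⟨l, i⟩)
    · simpa [hx] using (hb.apply_inr 0 0 x i).symm
    · rw [Fin.fin_one_eq_zero l, ← hb.apply_inl 0 x i, hb.skew, hx]
      simp
  obtain ⟨b₀, hb₀⟩ := hstd.self_of_nhds
  obtain ⟨g, hg⟩ := hb₀.exists_isCompat
  obtain ⟨T, hT⟩ := exists_equiv_of_injective (hnd hb₀)
  have hT' : ∀ f z, σ y₀ 0 (T.symm f) z = f z := fun f z => by rw [← hT]; simp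
  have hinj : ∀ x x', (∀ z, σ y₀ 0 x z = σ y₀ 0 x' z) → x = x' := fun x x' h =>
    T.injective (by ext z; simpa [← hT] using h z)
  obtain ⟨S, r, hS, hSinj, hr, hr'⟩ := exists_local_sqrt (E →L[ℝ] E)
  -- `A y` expresses `σ y` through `σ y₀` and tends to `1`. If its square root is self-adjoint for
  -- `σ y₀`, the root pulls `σ y₀` back to `σ y`, and so pulls `g` back to a scalar product
  -- compatible with `σ y`.
  let A : E → E →L[ℝ] E := fun y => (T.symm : (E →L[ℝ] ℝ) →L[ℝ] E).comp (σ y 0)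
  have hA : ∀ {y}, ContDiffAt ℝ ∞ σ y → ContDiffAt ℝ ∞ A y := fun h =>
    contDiffAt_const.clm_comp (contDiffAt_pi.1 h 0)
  have hA0 : A y₀ = 1 := by
    ext x
    simp [A, ← hT]
  have hAt : Filter.Tendsto A (𝓝 y₀) (𝓝 1) := hA0 ▸ (hA hσ.self_of_nhds).continuousAt
  let adj : (E →L[ℝ] E) → E →L[ℝ] E := fun X =>
    (T.symm : (E →L[ℝ] ℝ) →L[ℝ] E).comp ((σ y₀ 0).bilinearComp (ContinuousLinearMap.id ℝ E) X)
  have hadj : ∀ X x z, σ y₀ 0 (adj X x) z = σ y₀ 0 x (X z) := fun X x z => by simp [adj, hT']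
  have hadj1 : adj 1 = 1 := by
    ext x
    exact hinj _ _ fun z => by rw [hadj]; simp
  have hadjt : Filter.Tendsto adj (𝓝 1) (𝓝 1) := by
    have : ContDiffAt ℝ ∞ adj 1 := contDiffAt_const.clm_comp
      (contDiffAt_bilinearComp contDiffAt_const contDiffAt_const contDiffAt_id)
    simpa only [ContinuousAt, hadj1] using this.continuousAt
  refine ⟨fun y => pull (r (A y)) g, ?_⟩
  filter_upwards [hσ, hstd, hAt.eventually hr', (hr.comp hAt).eventually hS,
    (hadjt.comp (hr.comp hAt)).eventually hS] with y h ⟨b, hb⟩ ⟨hrs, hrr⟩ hrS hadjS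
  refine ⟨contDiffAt_pull contDiffAt_const (hrs.comp y (hA h)), ?_⟩
  have hAσ : ∀ x z, σ y₀ 0 (A y x) z = σ y 0 x z := fun x z => by simp [A, hT']
  have hsq : ∀ x, r (A y) (r (A y) x) = A y x := fun x => DFunLike.congr_fun hrr x
  -- `A y` is self-adjoint for `σ y₀`, so the adjoint of the root is another root near `1`; squaring
  -- is injective there.
  have hself : adj (r (A y)) = r (A y) := by
    refine hSinj hadjS hrS ?_
    change adj (r (A y)) * adj (r (A y)) = r (A y) * r (A y)
    ext x
    refine hinj _ _ fun z => ?_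
    change σ y₀ 0 (adj _ (adj _ x)) z = σ y₀ 0 (r (A y) (r (A y) x)) z
    rw [hadj, hadj, hsq, hsq, hb₀.skew, hAσ, hAσ, ← hb.skew]
  have hpull : ∀ x z, σ y₀ 0 (r (A y) x) (r (A y) z) = σ y 0 x z := fun x z => by
    rw [← hadj, hself, hsq, hAσ]
  have hinj' : LinearMap.ker (r (A y) : E →ₗ[ℝ] E) = ⊥ := by
    refine LinearMap.ker_eq_bot'.2 fun x hx => hnd hb x ?_
    ext z
    rw [← hpull, show r (A y) x = 0 from hx]
    simp
  let L : E ≃L[ℝ] E :=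
    (LinearEquiv.ofInjectiveEndo _ (LinearMap.ker_eq_bot.1 hinj')).toContinuousLinearEquiv
  have hL : (L : E →L[ℝ] E) = r (A y) := by
    ext x
    rfl
  have hc := hg.pull L
  rw [hL] at hc
  convert hc using 1
  ext j x z
  rw [Fin.fin_one_eq_zero j, pull_apply, hpull]

end Polysymplectic

end

noncomputable section

namespace Polysymplectic

variable {E : Type*} [NormedAddCommGroup E] [NormedSpace ℝ E] [FiniteDimensional ℝ E] {n s : ℕ}

/-! ### Local existence for several forms, by adapted frames -/

section Frame

variable (b : Module.Basis (Fin n ⊕ Fin s × Fin n) ℝ E) (m : Fin s)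

/-- For a standard basis `b` of `σ` and `m ≠ j` this is the identity. -/
def frameOp (σ : Fin s → Bil E) : E →L[ℝ] E :=
  ∑ i, ((σ m).flip (b (Sum.inr (m, i)))).smulRight (b (Sum.inl i)) +
    ∑ l, ∑ i, (σ l (b (Sum.inl i))).smulRight (b (Sum.inr (l, i)))

theorem frameOp_apply (σ : Fin s → Bil E) (x : E) : frameOp b m σ x =
    ∑ i, σ m x (b (Sum.inr (m, i))) • b (Sum.inl i) +
      ∑ l, ∑ i, σ l (b (Sum.inl i)) x • b (Sum.inr (l, i)) := by
  simp [frameOp]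

variable {b} in
theorem frameOp_eq_one {σ : Fin s → Bil E} (hb : IsStd σ b) : frameOp b m σ = 1 := by
  ext x
  rw [frameOp_apply]
  conv_rhs => rw [show (1 : E →L[ℝ] E) x = x from rfl, ← b.sum_repr x, Fintype.sum_sum_type, Fintype.sum_prod_type]
  simp only [hb.apply_inl, hb.apply_inr, if_true]
  rfl

theorem contDiffAt_frameOp {σ : E → Fin s → Bil E} {y : E} (hσ : ContDiffAt ℝ ∞ σ y) :
    ContDiffAt ℝ ∞ (fun y => frameOp b m (σ y)) y := by
  have h : ∀ l u v, ContDiffAt ℝ ∞ (fun y => σ y l u v) y := fun l =>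
    contDiffAt_bil_iff_apply.1 (contDiffAt_pi.1 hσ l)
  refine contDiffAt_clm_iff_apply.2 fun x => ?_
  simp only [frameOp_apply]
  exact (ContDiffAt.sum fun i _ => (h _ _ _).smul contDiffAt_const).add
    (ContDiffAt.sum fun l _ => ContDiffAt.sum fun i _ => (h _ _ _).smul contDiffAt_const)

/-- The vectors `w^j_k` adapted to `σ` and to the vectors `v_i` of `b`. -/
theorem exists_adapted {σ : Fin s → Bil E} {b' : Module.Basis (Fin n ⊕ Fin s × Fin n) ℝ E}
    (hb' : IsStd σ b') {j : Fin s} (hm : m ≠ j) (hinj : ∀ x, frameOp b m σ x = 0 → x = 0)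
    (k : Fin n) : ∃ c : Fin n → ℝ, frameOp b m σ (∑ i, c i • b' (Sum.inr (j, i))) =
      b (Sum.inr (j, k)) ∧
      ∀ i, σ j (b (Sum.inl i)) (∑ i, c i • b' (Sum.inr (j, i))) = if k = i then 1 else 0 := by
  classical
  let φ : (Fin n → ℝ) →ₗ[ℝ] (Fin n → ℝ) := LinearMap.pi fun i =>
    (σ j (b (Sum.inl i)) : E →ₗ[ℝ] ℝ) ∘ₗ
      (Fintype.linearCombination ℝ fun i => b' (Sum.inr (j, i)))
  have hφ : ∀ c i, φ c i = σ j (b (Sum.inl i)) (∑ i, c i • b' (Sum.inr (j, i))) := fun c i => by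
    simp [φ, Fintype.linearCombination_apply]
  -- On the `j`-th block of `b'` only the terms with `l = j` survive, the `m`-part vanishing because
  -- `m ≠ j`. So `frameOp` acts there by the matrix `φ`, and its injectivity makes `φ` invertible.
  have hN : ∀ c, frameOp b m σ (∑ i, c i • b' (Sum.inr (j, i))) =
      ∑ i, φ c i • b (Sum.inr (j, i)) := fun c => by
    have h0 : ∀ l, l ≠ j → ∀ x, σ l x (∑ i, c i • b' (Sum.inr (j, i))) = 0 := fun l hl x => by
      simp [hb'.apply_inr, hl.symm]
    have h1 : ∀ x, σ m (∑ i, c i • b' (Sum.inr (j, i))) x = 0 := fun x => by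
      rw [hb'.skew, h0 m hm, neg_zero]
    rw [frameOp_apply, Finset.sum_eq_zero, zero_add, Finset.sum_eq_single j]
    · simp only [hφ]
    · intro l _ hl
      exact Finset.sum_eq_zero fun i _ => by rw [h0 l hl, zero_smul]
    · simp
    · intro i _
      rw [h1, zero_smul]
  have hφinj : Function.Injective φ := (injective_iff_map_eq_zero φ).2 fun c hc => by
    have := hinj _ (by rw [hN, hc]; simp)
    have hli := b'.linearIndependent.comp (fun i : Fin n => (Sum.inr (j, i) : Fin n ⊕ Fin s × Fin n))
      (fun i k h => by simpa using h)
    exact funext (Fintype.linearIndependent_iff.1 hli c this)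
  obtain ⟨c, hc⟩ := (LinearMap.injective_iff_surjective.1 hφinj) (Pi.single k 1)
  refine ⟨c, ?_, fun i => ?_⟩
  · rw [hN, hc]
    simp [Pi.single_apply]
  · rw [← hφ, hc, Pi.single_apply]
    simp [eq_comm]

end Frame

/-- Compatible scalar products for a smooth family of polysymplectic structures with at least two
forms. -/
theorem exists_local_compat_of_two_le (hs : 2 ≤ s) {σ : E → Fin s → Bil E} {y₀ : E}
    (hσ : ∀ᶠ y in 𝓝 y₀, ContDiffAt ℝ ∞ σ y)
    (hstd : ∀ᶠ y in 𝓝 y₀, ∃ b : Module.Basis (Fin n ⊕ Fin s × Fin n) ℝ E, IsStd (σ y) b) :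
    ∃ γ : E → Bil E, ∀ᶠ y in 𝓝 y₀, ContDiffAt ℝ ∞ γ y ∧ IsCompat n (σ y) (γ y) := by
  classical
  have : CompleteSpace E := FiniteDimensional.complete ℝ E
  obtain ⟨b, hb⟩ := hstd.self_of_nhds
  have : Nontrivial (Fin s) := Fin.nontrivial_iff_two_le.2 hs
  choose m hm using fun j : Fin s => exists_ne j
  let N : Fin s → E → E →L[ℝ] E := fun j y => frameOp b (m j) (σ y)
  let v : Fin n → E := fun i => b (Sum.inl i)
  -- The bases given by `hstd` need not vary smoothly, but these vectors do. By `exists_adapted`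
  -- each lies in the `j`-th block of any standard basis at `y`, and they are dual to the fixed `v
  -- i` under `σ y j`.
  let w : Fin s → Fin n → E → E := fun j k y =>
    (N j y).inverse (b (Sum.inr (j, k)))
  -- Corrects `v i` to make the family isotropic. The factor `1 / 2` appears because the corrections
  -- of both arguments of `σ` contribute equally.
  let v' : Fin n → E → E := fun i y =>
    v i + (1 / 2 : ℝ) • ∑ j, ∑ k, σ y j (v i) (v k) • w j k y
  let j₀ : Fin s := ⟨0, by omega⟩
  -- The sum of squares of the dual coordinates: `w j₀ i` reads the `v' i`-coordinate through `σ y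
  -- j₀`, and `v' i` reads the `w j i`-coordinate through `σ y j`.
  let γ : E → Bil E := fun y =>
    ∑ i, ((σ y j₀).flip (w j₀ i y)).smulRight ((σ y j₀).flip (w j₀ i y)) +
      ∑ j, ∑ i, (σ y j (v' i y)).smulRight (σ y j (v' i y))
  have hγ : ∀ y x z, γ y x z = ∑ i, σ y j₀ x (w j₀ i y) * σ y j₀ z (w j₀ i y) +
      ∑ j, ∑ i, σ y j (v' i y) x * σ y j (v' i y) z := fun y x z => by
    simp [γ]
  have hN : ∀ j {y}, ContDiffAt ℝ ∞ σ y → ContDiffAt ℝ ∞ (N j) y := fun j y h =>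
    contDiffAt_frameOp b (m j) h
  have hinv : ∀ᶠ y in 𝓝 y₀, ∀ j, ∃ e : E ≃L[ℝ] E, (e : E →L[ℝ] E) = N j y := by
    refine Filter.eventually_all.2 fun j => (hN j hσ.self_of_nhds).continuousAt.eventually
      (p := fun T => ∃ e : E ≃L[ℝ] E, (e : E →L[ℝ] E) = T) ?_
    have h1 : N j y₀ = (ContinuousLinearEquiv.refl ℝ E : E →L[ℝ] E) := frameOp_eq_one (m j) hb
    rw [h1]
    exact ContinuousLinearEquiv.nhds _
  refine ⟨γ, ?_⟩
  filter_upwards [hσ, hstd, hinv] with y hy ⟨b', hb'⟩ hinv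
  have hw : ∀ j k, ∃ c : Fin n → ℝ, w j k y = ∑ i, c i • b' (Sum.inr (j, i)) ∧
      ∀ i, σ y j (v i) (w j k y) = if k = i then 1 else 0 := fun j k => by
    obtain ⟨e, he⟩ := hinv j
    obtain ⟨c, hc, hc'⟩ := exists_adapted b (m j) hb' (hm j)
      (fun x hx => by
        have : e x = 0 := by rw [← hx]; exact DFunLike.congr_fun he x
        simpa using this) k
    have h1 : w j k y = ∑ i, c i • b' (Sum.inr (j, i)) := by
      simp only [w, ← he, ContinuousLinearMap.inverse_equiv]
      refine e.symm_apply_eq.2 (hc.symm.trans (DFunLike.congr_fun he _).symm)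
    exact ⟨c, h1, fun i => by rw [h1, hc']⟩
  have hwl : ∀ l j k x, l ≠ j → σ y l x (w j k y) = 0 := fun l j k x hl => by
    obtain ⟨c, hc, -⟩ := hw j k
    simp [hc, hb'.apply_inr, hl.symm]
  have hww : ∀ l j i p k, σ y l (w j i y) (w p k y) = 0 := fun l j i p k => by
    obtain ⟨c, hc, -⟩ := hw p k
    obtain ⟨d, hd, -⟩ := hw j i
    simp [hc, hd, hb'.apply_inr, Module.Basis.coord_apply]
  have hvw : ∀ l i j k, σ y l (v i) (w j k y) = if j = l ∧ k = i then 1 else 0 := by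
    intro l i j k
    by_cases hl : j = l
    · subst hl
      simp [(hw j k).choose_spec.2]
    · rw [hwl l j k _ (Ne.symm hl), if_neg (fun h => hl h.1)]
  have hv'w : ∀ l i j k, σ y l (v' i y) (w j k y) = if j = l ∧ k = i then 1 else 0 := by
    intro l i j k
    simp [v', hvw, hww]
  have hwv' : ∀ l i j k, σ y l (w j k y) (v' i y) = if j = l ∧ k = i then -1 else 0 := by
    intro l i j k
    rw [hb'.skew, hv'w]
    split_ifs <;> simp
  have hv'v' : ∀ l i k, σ y l (v' i y) (v' k y) = 0 := by
    intro l i k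
    have h1 : σ y l (v i) (v' k y) = σ y l (v i) (v k) + 1 / 2 * σ y l (v k) (v i) := by
      simp [v', hvw, ite_and]
    have h2 : ∀ x, σ y l (v' i y) x = σ y l (v i) x +
        1 / 2 * ∑ p, ∑ q, σ y p (v i) (v q) * σ y l (w p q y) x := by
      intro x
      simp [v']
    rw [h2, h1]
    simp only [hwv', ite_and]
    simp
    rw [hb'.skew l (v k) (v i)]
    ring
  constructor
  · have hw' : ∀ j k, ContDiffAt ℝ ∞ (w j k) y := fun j k => by
      obtain ⟨e, he⟩ := hinv j
      have := contDiffAt_map_inverse (n := ∞) e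
      rw [he] at this
      exact (this.comp y (hN j hy)).clm_apply contDiffAt_const
    have hσ' : ∀ j, ContDiffAt ℝ ∞ (fun y => σ y j) y := contDiffAt_pi.1 hy
    have hv' : ∀ i, ContDiffAt ℝ ∞ (v' i) y := fun i =>
      contDiffAt_const.add (contDiffAt_const.smul (ContDiffAt.sum fun j _ => ContDiffAt.sum fun k _ =>
        (((hσ' j).clm_apply contDiffAt_const).clm_apply contDiffAt_const).smul (hw' j k)))
    refine contDiffAt_bil_iff_apply.2 fun x z => ?_
    simp only [hγ]
    refine (ContDiffAt.sum fun i _ => ?_).add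
      (ContDiffAt.sum fun j _ => ContDiffAt.sum fun i _ => ?_)
    · exact (((hσ' _).clm_apply contDiffAt_const).clm_apply (hw' _ _)).mul
        (((hσ' _).clm_apply contDiffAt_const).clm_apply (hw' _ _))
    · exact (((hσ' _).clm_apply (hv' _)).clm_apply contDiffAt_const).mul
        (((hσ' _).clm_apply (hv' _)).clm_apply contDiffAt_const)
  · refine isCompat_of_family (Module.finrank_eq_card_basis b) hb'.skew (fun i => v' i y)
      (fun j k => w j k y) hv'v' (fun j i l k => hv'w j i l k) hww ?_ ?_ ?_ ?_
    · intro i k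
      simp only [hγ, hv'w, hv'v']
      simp [eq_comm]
    · intro i l k
      simp only [hγ, hv'v', hww]
      simp
    · intro i l k
      simp only [hγ, hv'v', hww]
      simp
    · intro l i p k
      simp only [hγ, hv'w, hww]
      rw [show ∑ _ : Fin n, (0 : ℝ) * 0 = 0 by simp, zero_add, Finset.sum_eq_single l,
        Finset.sum_eq_single i]
      · simp [eq_comm]
      · intro q _ hq
        simp [hq.symm]
      · simp
      · intro q _ hq
        simp [hq.symm]
      · simp

theorem exists_local_compat (hs : 1 ≤ s) {σ : E → Fin s → Bil E} {y₀ : E}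
    (hσ : ∀ᶠ y in 𝓝 y₀, ContDiffAt ℝ ∞ σ y)
    (hstd : ∀ᶠ y in 𝓝 y₀, ∃ b : Module.Basis (Fin n ⊕ Fin s × Fin n) ℝ E, IsStd (σ y) b) :
    ∃ γ : E → Bil E, ∀ᶠ y in 𝓝 y₀, ContDiffAt ℝ ∞ γ y ∧ IsCompat n (σ y) (γ y) := by
  rcases hs.eq_or_lt with rfl | hs
  · exact exists_local_compat_one hσ hstd
  · exact exists_local_compat_of_two_le hs hσ hstd

end Polysymplectic

end

noncomputable section

namespace Polysymplectic

/-! ### Fields of bilinear forms on the manifold -/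

section Fields

variable {E : Type*} [NormedAddCommGroup E] [NormedSpace ℝ E] {n s : ℕ}
  {M : Type*} [TopologicalSpace M] [ChartedSpace E M]

/-- The field of bilinear forms `g` is smooth at `p`. -/
def IsSmoothAt (g : M → Bil E) (p : M) : Prop :=
  ContDiffAt ℝ ∞ (bilInChart g p) (chartAt E p p)

theorem eventually_chart_symm {P : M → Prop} {x₀ p : M} (hp : p ∈ (chartAt E x₀).source)
    (h : ∀ᶠ q in 𝓝 p, P q) : ∀ᶠ y in 𝓝 (chartAt E x₀ p), P ((chartAt E x₀).symm y) := by
  have ht := (chartAt E x₀).continuousAt_symm ((chartAt E x₀).map_source hp)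
  rw [ContinuousAt, (chartAt E x₀).left_inv hp] at ht
  exact ht.eventually h

theorem IsSmoothAt.congr {g g' : M → Bil E} {p : M} (h : IsSmoothAt g p) (hg : g' =ᶠ[𝓝 p] g) :
    IsSmoothAt g' p := by
  refine ContDiffAt.congr_of_eventuallyEq h ?_
  filter_upwards [eventually_chart_symm (mem_chart_source E p) hg] with y hy
  rw [bilInChart, bilInChart, hy]

variable [IsManifold 𝓘(ℝ, E) ∞ M]

theorem isSmoothAt_iff {g : M → Bil E} (x₀ : M) {p : M} (hp : p ∈ (chartAt E x₀).source) :
    IsSmoothAt g p ↔ ContDiffAt ℝ ∞ (bilInChart g x₀) (chartAt E x₀ p) :=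
  (contMDiffAt_bil_iff g p (mem_chart_source E p)).symm.trans (contMDiffAt_bil_iff g x₀ hp)

/-- The interpolation of fields of scalar products. -/
def Interpolation.field (Φ : Interpolation E n s) (S : Fin s → M → Bil E) (g₀ g₁ : M → Bil E)
    (ρ : M → ℝ) (p : M) : Bil E :=
  Φ.toFun (fun j => S j p, g₀ p, g₁ p, ρ p)

/-- Naturality applied to the derivative of the inverse chart. -/
theorem Interpolation.bilInChart_field (Φ : Interpolation E n s) {S : Fin s → M → Bil E}
    {g₀ g₁ : M → Bil E} {ρ : M → ℝ} (h₀ : ∀ p, IsCompat n (fun j => S j p) (g₀ p))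
    (h₁ : ∀ p, IsCompat n (fun j => S j p) (g₁ p)) (hρ : ∀ p, ρ p ∈ Set.Icc (0 : ℝ) 1) (x₀ : M)
    {y : E} (hy : y ∈ (chartAt E x₀).target) :
    bilInChart (Φ.field S g₀ g₁ ρ) x₀ y = Φ.toFun (fun j => bilInChart (S j) x₀ y,
      bilInChart g₀ x₀ y, bilInChart g₁ x₀ y, ρ ((chartAt E x₀).symm y)) := by
  obtain ⟨L, hL⟩ := isInvertible_mfderiv_chart_symm x₀ hy
  simp only [bilInChart, ← hL]
  exact Φ.natural (h₀ _) (h₁ _) (hρ _) L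

theorem isCompat_bilInChart {S : Fin s → M → Bil E}
    {g : M → Bil E} (h : ∀ p, IsCompat n (fun j => S j p) (g p)) (x₀ : M)
    {y : E} (hy : y ∈ (chartAt E x₀).target) :
    IsCompat n (fun j => bilInChart (S j) x₀ y) (bilInChart g x₀ y) := by
  obtain ⟨L, hL⟩ := isInvertible_mfderiv_chart_symm x₀ hy
  simp only [bilInChart, ← hL]
  exact (h _).pull L

theorem Interpolation.isSmoothAt_field (Φ : Interpolation E n s) {S : Fin s → M → Bil E}
    {g₀ g₁ : M → Bil E} {ρ : M → ℝ} (h₀ : ∀ p, IsCompat n (fun j => S j p) (g₀ p))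
    (h₁ : ∀ p, IsCompat n (fun j => S j p) (g₁ p)) (hρ : ∀ p, ρ p ∈ Set.Icc (0 : ℝ) 1)
    {p : M} (hS : ∀ j, IsSmoothAt (S j) p) (hg₀ : IsSmoothAt g₀ p) (hg₁ : IsSmoothAt g₁ p)
    (hρs : ContMDiffAt 𝓘(ℝ, E) 𝓘(ℝ) ∞ ρ p) : IsSmoothAt (Φ.field S g₀ g₁ ρ) p := by
  have hp := (chartAt E p).map_source (mem_chart_source E p)
  have hρ' : ContDiffAt ℝ ∞ (fun y => ρ ((chartAt E p).symm y)) (chartAt E p p) := by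
    have := contMDiffAt_iff_source_of_mem_source (x := p) (mem_chart_source E p) |>.1 hρs
    simpa [extChartAt, contMDiffWithinAt_univ, contMDiffAt_iff_contDiffAt] using! this
  refine ContDiffAt.congr_of_eventuallyEq (f := fun y => Φ.toFun (fun j => bilInChart (S j) p y,
      bilInChart g₀ p y, bilInChart g₁ p y, ρ ((chartAt E p).symm y))) ?_ ?_
  · exact (Φ.smooth (isCompat_bilInChart h₀ p hp) (isCompat_bilInChart h₁ p hp) (hρ _)).comp
      (chartAt E p p) (f := fun y => (fun j => bilInChart (S j) p y,
        bilInChart g₀ p y, bilInChart g₁ p y, ρ ((chartAt E p).symm y)))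
      ((contDiffAt_pi.2 hS).prodMk (hg₀.prodMk (hg₁.prodMk hρ')))
  · filter_upwards [(chartAt E p).open_target.mem_nhds hp] with y hy
    exact Φ.bilInChart_field h₀ h₁ hρ p hy

theorem exists_local_field [FiniteDimensional ℝ E] (hs : 1 ≤ s) {S : Fin s → M → Bil E}
    (hS : ∀ j p, IsSmoothAt (S j) p)
    (hstd : ∀ p, ∃ b : Module.Basis (Fin n ⊕ Fin s × Fin n) ℝ E, IsStd (fun j => S j p) b)
    (p : M) : ∃ γ : M → Bil E, (∀ q, IsCompat n (fun j => S j q) (γ q)) ∧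
      ∀ᶠ q in 𝓝 p, IsSmoothAt γ q := by
  classical
  have hp := (chartAt E p).map_source (mem_chart_source E p)
  have ht := (chartAt E p).open_target.mem_nhds hp
  obtain ⟨γ, hγ⟩ := exists_local_compat (n := n) hs (σ := fun y j => bilInChart (S j) p y)
    (y₀ := chartAt E p p)
    (by
      filter_upwards [ht] with y hy
      refine contDiffAt_pi.2 fun j => ?_
      have := (isSmoothAt_iff p ((chartAt E p).map_target hy)).1 (hS j ((chartAt E p).symm y))
      rwa [(chartAt E p).right_inv hy] at this)
    (by
      filter_upwards [ht] with y hy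
      obtain ⟨L, hL⟩ := isInvertible_mfderiv_chart_symm p hy
      obtain ⟨b, hb⟩ := hstd ((chartAt E p).symm y)
      simp only [bilInChart, ← hL]
      exact ⟨_, hb.pull L⟩)
  choose b hb using hstd
  choose γ₀ hγ₀ using fun q => (hb q).exists_isCompat
  let D : E → E →L[ℝ] E := fun y => mfderiv 𝓘(ℝ, E) 𝓘(ℝ, E) (chartAt E p).symm y
  let γ₁ : M → Bil E := fun q => pull (D (chartAt E p q)).inverse (γ (chartAt E p q))
  -- Away from `p` an arbitrary compatible value is used, so that the field is compatible everywhere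
  -- and `Φ` can be applied without restricting domains; smoothness is only needed near `p`.
  let γ₂ : M → Bil E := fun q => if IsCompat n (fun j => S j q) (γ₁ q) then γ₁ q else γ₀ q
  have h₁ : ∀ y ∈ (chartAt E p).target, bilInChart γ₁ p y = γ y := fun y hy => by
    obtain ⟨L, hL⟩ := isInvertible_mfderiv_chart_symm p hy
    have hD : D y = L := hL.symm
    ext u v
    simp only [bilInChart, γ₁, ← hL, pull_apply]
    rw [(chartAt E p).right_inv hy, hD, ContinuousLinearMap.inverse_equiv]
    simp
  have hq : ∀ᶠ q in 𝓝 p, q ∈ (chartAt E p).source ∧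
      ContDiffAt ℝ ∞ γ (chartAt E p q) ∧ IsCompat n (fun j => S j q) (γ₁ q) := by
    filter_upwards [(chartAt E p).open_source.mem_nhds (mem_chart_source E p),
      ((chartAt E p).continuousAt (mem_chart_source E p)).eventually hγ] with q hq ⟨hs, hc⟩
    refine ⟨hq, hs, ?_⟩
    have hy := (chartAt E p).map_source hq
    obtain ⟨L, hL⟩ := isInvertible_mfderiv_chart_symm p hy
    convert hc.pull L.symm using 1
    · ext j u v
      simp only [bilInChart, ← hL, pull_apply, (chartAt E p).left_inv hq]
      simp
    · simp only [γ₁, D, ← hL, ContinuousLinearMap.inverse_equiv]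
  refine ⟨γ₂, fun q => ?_, ?_⟩
  · by_cases h : IsCompat n (fun j => S j q) (γ₁ q)
    · simpa only [γ₂, if_pos h] using h
    · simpa only [γ₂, if_neg h] using hγ₀ q
  · filter_upwards [hq.eventually_nhds] with q hq
    obtain ⟨hqs, hqγ, -⟩ := hq.self_of_nhds
    have : IsSmoothAt γ₁ q := by
      refine (isSmoothAt_iff p hqs).2 (hqγ.congr_of_eventuallyEq ?_)
      filter_upwards [(chartAt E p).open_target.mem_nhds ((chartAt E p).map_source hqs)] with y hy
      exact h₁ y hy
    refine this.congr ?_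
    filter_upwards [hq] with q' hq'
    simp only [γ₂, if_pos hq'.2.2]

end Fields

end Polysymplectic

end

noncomputable section

namespace Polysymplectic

/-! ### Gluing local fields along the interpolation -/

section Gluing

variable {E : Type*} [NormedAddCommGroup E] [NormedSpace ℝ E] {n s : ℕ}
  {M : Type*} [TopologicalSpace M] [ChartedSpace E M]

/-- A sequence of fields which is locally eventually constant has a limit field. -/
theorem exists_limit_of_locally_eventually_const {α : Type*} {G : ℕ → M → α}
    (hG : ∀ p, ∃ K, ∀ᶠ q in 𝓝 p, ∀ k ≥ K, G k q = G K q) :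
    ∃ g : M → α, ∀ p, ∃ K, ∀ k ≥ K, g =ᶠ[𝓝 p] G k := by
  choose K hK using hG
  refine ⟨fun p => G (K p) p, fun p => ⟨K p, fun k hk => ?_⟩⟩
  filter_upwards [hK p] with q hq
  rw [hq k hk, ← (hK q).self_of_nhds _ (le_max_left (K q) (K p)), hq _ (le_max_right _ _)]

variable [IsManifold 𝓘(ℝ, E) ∞ M] [FiniteDimensional ℝ E] [T2Space M] [SecondCountableTopology M]

/-- Starting from an arbitrary, possibly discontinuous compatible field, each step pushes the
current field towards one local field by the amount of a bump function. Where the bump function is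
`1` the result is smooth, later steps preserve this, and local finiteness makes the sequence
stabilise near every point. -/
theorem exists_global_field (hs : 1 ≤ s) {S : Fin s → M → Bil E}
    (hS : ∀ j p, IsSmoothAt (S j) p)
    (hstd : ∀ p, ∃ b : Module.Basis (Fin n ⊕ Fin s × Fin n) ℝ E, IsStd (fun j => S j p) b) :
    ∃ g : M → Bil E, (∀ p, IsCompat n (fun j => S j p) (g p)) ∧ ∀ p, IsSmoothAt g p := by
  classical
  have : LocallyCompactSpace E := 𝓘(ℝ, E).locallyCompactSpace
  have : LocallyCompactSpace M := ChartedSpace.locallyCompactSpace E M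
  obtain ⟨Φ⟩ := nonempty_interpolation E n hs
  choose γ hγ hγs using exists_local_field hs hS hstd
  obtain ⟨ι, f, hf⟩ := SmoothBumpCovering.exists_isSubordinate 𝓘(ℝ, E) (s := Set.univ)
    (U := fun p => {q | IsSmoothAt (γ p) q}) isClosed_univ (fun p _ => hγs p)
  have hcount : Countable ι := Set.countable_univ_iff.1
    (f.locallyFinite.countable_univ fun i => (f i).nonempty_support)
  obtain ⟨enc⟩ := nonempty_encodable ι
  choose γ₀ hγ₀ using fun q => (hstd q).choose_spec.exists_isCompat
  -- `decode₂` succeeds at `k` only for the index encoded by `k`, so each bump function is used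
  -- exactly once; at other `k` nothing changes.
  let G : ℕ → M → Bil E := fun k => Nat.rec γ₀ (fun k g =>
    (Encodable.decode₂ ι k).elim g fun i => Φ.field S g (γ (f.c i)) (f i)) k
  have hGn : ∀ k, Encodable.decode₂ ι k = none → G (k + 1) = G k := fun k h => by
    simp only [G, h, Option.elim]
  have hGs : ∀ k i, Encodable.decode₂ ι k = some i →
      G (k + 1) = Φ.field S (G k) (γ (f.c i)) (f i) := fun k i h => by
    simp only [G, h, Option.elim]
  have hc : ∀ k p, IsCompat n (fun j => S j p) (G k p) := by
    intro k
    induction k with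
    | zero => exact hγ₀
    | succ k ih =>
      intro p
      rcases h : Encodable.decode₂ ι k with _ | i
      · rw [hGn k h]
        exact ih p
      · rw [hGs k i h]
        exact Φ.compat (ih p) (hγ _ p) (f i).mem_Icc
  have hzero : ∀ k i p, Encodable.decode₂ ι k = some i → f i p = 0 → G (k + 1) p = G k p := by
    intro k i p h h0
    rw [hGs k i h, Interpolation.field, h0]
    exact Φ.zero (hc k p) (hγ _ p)
  obtain ⟨g, hg⟩ := exists_limit_of_locally_eventually_const (G := G) fun p => by
    obtain ⟨t, ht, hfin⟩ := f.locallyFinite p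
    obtain ⟨K, hK⟩ : ∃ K, ∀ i, (Function.support (f i) ∩ t).Nonempty → Encodable.encode i < K := by
      obtain ⟨K, hK⟩ := (hfin.image Encodable.encode).bddAbove
      exact ⟨K + 1, fun i hi => Nat.lt_succ_of_le (hK ⟨i, hi, rfl⟩)⟩
    refine ⟨K, Filter.mem_of_superset ht fun q hq k hk => ?_⟩
    induction k, hk using Nat.le_induction with
    | base => rfl
    | succ k hk ih =>
      refine Eq.trans ?_ ih
      rcases h : Encodable.decode₂ ι k with _ | i
      · rw [hGn k h]
      · refine hzero k i q h ?_
        by_contra hne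
        have := hK i ⟨q, hne, hq⟩
        rw [Encodable.mem_decode₂.1 h] at this
        omega
  refine ⟨g, fun p => ?_, fun p => ?_⟩
  · obtain ⟨K, hK⟩ := hg p
    rw [(hK K le_rfl).self_of_nhds]
    exact hc K p
  · obtain ⟨K, hK⟩ := hg p
    let i₀ := f.ind p (Set.mem_univ p)
    -- At the step of `i₀` the parameter is `1` near `p`, so whatever came before is replaced by a
    -- local field smooth at `p`.
    have hstart : IsSmoothAt (G (Encodable.encode i₀ + 1)) p := by
      have hp : p ∈ tsupport (f i₀) := subset_tsupport _ (f.mem_support_ind p (Set.mem_univ p))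
      refine IsSmoothAt.congr (hf i₀ hp) ?_
      filter_upwards [f.eventuallyEq_one p (Set.mem_univ p)] with q hq
      rw [hGs _ i₀ (Encodable.encodek₂ i₀), Interpolation.field, show f i₀ q = 1 from hq]
      exact Φ.one (hc _ q) (hγ _ q)
    have hstep : ∀ k ≥ Encodable.encode i₀ + 1, IsSmoothAt (G k) p := by
      intro k hk
      induction k, hk using Nat.le_induction with
      | base => exact hstart
      | succ k hk ih =>
        rcases h : Encodable.decode₂ ι k with _ | i
        · rwa [hGn k h]
        -- On the closed support of the bump function the local field is smooth by subordination;
        -- off it the step changes nothing near `p`.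
        · by_cases hp : p ∈ tsupport (f i)
          · rw [hGs k i h]
            exact Φ.isSmoothAt_field (hc k) (hγ _) (fun q => (f i).mem_Icc) (fun j => hS j p) ih
              (hf i hp) (f i).contMDiffAt
          · refine ih.congr ?_
            filter_upwards [notMem_tsupport_iff_eventuallyEq.1 hp] with q hq
            exact hzero k i q h hq
    exact (hstep _ (le_max_right K _)).congr (hK _ (le_max_left _ _))

end Gluing

/-! ### From fields of bilinear forms to Riemannian metrics -/

section Bridge

variable {E : Type*} [NormedAddCommGroup E] [NormedSpace ℝ E] {n s : ℕ}
  {M : Type*} [TopologicalSpace M] [ChartedSpace E M]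

theorem bilInChart_toBil (Ω : (p : M) → TangentSpace 𝓘(ℝ, E) p [⋀^Fin 2]→L[ℝ] ℝ) (x₀ : M) (y : E) :
    bilInChart (fun p : M => toBil E (Ω p)) x₀ y = toBil E (formInChart Ω x₀ y) := by
  ext u v
  refine (toBil_apply (E := E) _ _ _).trans (Eq.trans ?_ (toBil_apply _ _ _).symm)
  refine congrArg (Ω ((chartAt E x₀).symm y)) ?_
  ext i
  fin_cases i <;> rfl

theorem isSmoothAt_toBil [FiniteDimensional ℝ E]
    {Ω : (p : M) → TangentSpace 𝓘(ℝ, E) p [⋀^Fin 2]→L[ℝ] ℝ} (hΩ : IsSmoothForm Ω) (p : M) :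
    IsSmoothAt (fun p : M => toBil E (Ω p)) p := by
  have hp := (chartAt E p).map_source (mem_chart_source E p)
  have h := (hΩ p).contDiffAt ((chartAt E p).open_target.mem_nhds hp)
  refine contDiffAt_bil_iff_apply.2 fun u v => ?_
  refine ((ContinuousAlternatingMap.apply ℝ E ℝ ![u, v]).contDiff.contDiffAt.comp _
    h).congr_of_eventuallyEq (Filter.Eventually.of_forall fun y => ?_)
  exact (congrArg (fun B : Bil E => B u v) (bilInChart_toBil Ω p y)).trans (toBil_apply _ _ _)

theorem isStd_toBil_iff {Ω : Fin s → E [⋀^Fin 2]→L[ℝ] ℝ}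
    {b : Module.Basis (Fin n ⊕ Fin s × Fin n) ℝ E} :
    IsStd (fun j => toBil E (Ω j)) b ↔ IsStandardBasis Ω b := by
  simp only [IsStd, IsStandardBasis, toBil_apply]

theorem IsOrthonormalBasis.isVonNBounded {ι : Type*} [Fintype ι] {g : Bil E}
    {b : Module.Basis ι ℝ E} (h : IsOrthonormalBasis g b) :
    Bornology.IsVonNBounded ℝ {v : E | g v v < 1} := by
  rw [NormedSpace.isVonNBounded_iff, isBounded_iff_forall_norm_le]
  refine ⟨∑ a, ‖b a‖, fun v hv => ?_⟩
  rw [← b.sum_repr v]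
  refine norm_sum_le_of_le _ fun a _ => ?_
  rw [norm_smul]
  refine mul_le_of_le_one_left (norm_nonneg _) ?_
  have h1 : b.coord a v * b.coord a v ≤ ∑ a, b.coord a v * b.coord a v :=
    Finset.single_le_sum (f := fun a => b.coord a v * b.coord a v)
      (fun _ _ => mul_self_nonneg _) (Finset.mem_univ a)
  rw [← isOrthonormalBasis_eq_sum h] at h1
  have h2 : b.coord a v * b.coord a v < 1 := h1.trans_lt hv
  rw [Real.norm_eq_abs]
  exact ((sq_lt_one_iff_abs_lt_one _).1 (by rwa [sq])).le

theorem IsCompat.isVonNBounded {σ : Fin s → Bil E} {g : Bil E} (h : IsCompat n σ g) :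
    Bornology.IsVonNBounded ℝ {v : E | g v v < 1} :=
  let ⟨_, _, hb⟩ := h
  hb.isVonNBounded

variable [IsManifold 𝓘(ℝ, E) ∞ M] [FiniteDimensional ℝ E]

/-- The metric given by a smooth field of scalar products. -/
def toMetric {S : Fin s → M → Bil E} (g : M → Bil E) (hg : ∀ p, IsCompat n (fun j => S j p) (g p))
    (hs : ∀ p, IsSmoothAt g p) :
    SmoothMetric E M where
  inner := g
  symm p := (hg p).isPos.1
  pos p := (hg p).isPos.2
  isVonNBounded p := (hg p).isVonNBounded
  contMDiff p := (contMDiffAt_bil_iff g p (mem_chart_source E p)).2 (hs p)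

/-- The field of scalar products of a metric. -/
def metricField (g : SmoothMetric E M) (p : M) : Bil E := g.inner p

theorem isSmoothAt_metricField (g : SmoothMetric E M) (p : M) : IsSmoothAt (metricField g) p :=
  (contMDiffAt_bil_iff (metricField g) p (mem_chart_source E p)).1 (g.contMDiff p)

theorem isCompatible_iff {Ω : Fin s → (p : M) → TangentSpace 𝓘(ℝ, E) p [⋀^Fin 2]→L[ℝ] ℝ}
    {g : SmoothMetric E M} :
    IsCompatible n Ω g ↔ ∀ p, IsCompat n (fun j => toBil E (Ω j p)) (metricField g p) := by
  refine forall_congr' fun p => exists_congr fun b => and_congr_left fun _ => ?_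
  exact (isStd_toBil_iff (E := E) (Ω := fun j => Ω j p) (b := b)).symm

theorem metric_ext {g g' : SmoothMetric E M} (h : metricField g = metricField g') : g = g' := by
  cases g
  cases g'
  congr

theorem nonempty_compatibleMetric [T2Space M] [SecondCountableTopology M] (hs : 1 ≤ s)
    {Ω : Fin s → (p : M) → TangentSpace 𝓘(ℝ, E) p [⋀^Fin 2]→L[ℝ] ℝ} (hΩ : IsPolysymplectic n Ω) :
    Nonempty (CompatibleMetric n Ω) := by
  obtain ⟨g, hg, hgs⟩ := exists_global_field (n := n) hs
    (S := fun j p => toBil E (Ω j p)) (fun j p => isSmoothAt_toBil (hΩ.smooth j) p)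
    (fun p => (hΩ.exists_standardBasis p).imp fun b hb => isStd_toBil_iff.2 hb)
  exact ⟨toMetric g hg hgs, isCompatible_iff.2 hg⟩

end Bridge

end Polysymplectic

end

noncomputable section

namespace Polysymplectic

/-! ### The contraction and its continuity -/

section Contraction

theorem tendstoUniformlyOn_iteratedFDeriv_const {ι E F : Type*}
    [NormedAddCommGroup E] [NormedSpace ℝ E] [NormedAddCommGroup F] [NormedSpace ℝ F]
    {l : Filter ι} {c : ι → F} {c₀ : F} (h : Filter.Tendsto c l (𝓝 c₀)) (K : Set E) (k : ℕ) :
    TendstoUniformlyOn (fun i => iteratedFDeriv ℝ k (fun _ : E => c i))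
      (iteratedFDeriv ℝ k (fun _ : E => c₀)) l K := by
  rcases k with _ | k
  · rw [tendstoUniformlyOn_iteratedFDeriv_zero_iff]
    exact h.tendstoUniformlyOn_const K
  · simp only [iteratedFDeriv_succ_const]
    exact Metric.tendstoUniformlyOn_iff.2 fun ε hε =>
      Filter.Eventually.of_forall fun _ _ _ => by simpa using hε

theorem tendstoUniformlyOn_self {ι E F : Type*} [UniformSpace F] {l : Filter ι} (f : E → F)
    (K : Set E) : TendstoUniformlyOn (fun _ : ι => f) f l K :=
  fun _ hu => Filter.Eventually.of_forall fun _ _ _ => refl_mem_uniformity hu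

variable {E : Type*} [NormedAddCommGroup E] [NormedSpace ℝ E] [FiniteDimensional ℝ E] {n s : ℕ}
  {M : Type*} [TopologicalSpace M] [ChartedSpace E M] [IsManifold 𝓘(ℝ, E) ∞ M]

theorem continuous_to_metric_iff {Z : Type*} [TopologicalSpace Z] {H : Z → SmoothMetric E M} :
    Continuous H ↔ ∀ (z : Z) (x₀ : M) (k : ℕ) (K : Set E), IsCompact K →
      K ⊆ (chartAt E x₀).target → TendstoUniformlyOn
        (fun z => iteratedFDeriv ℝ k (bilInChart (metricField (H z)) x₀))
        (iteratedFDeriv ℝ k (bilInChart (metricField (H z)) x₀)) (𝓝 z) K := by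
  rw [continuous_iInf_rng]
  simp only [continuous_induced_rng, continuous_iInf_rng]
  constructor
  · intro h z x₀ k K hKc hK
    exact UniformOnFun.tendsto_iff_tendstoUniformlyOn.1 ((h x₀ k).tendsto z) K ⟨hKc, hK⟩
  · intro h x₀ k
    refine continuous_iff_continuousAt.2 fun z => ?_
    exact UniformOnFun.tendsto_iff_tendstoUniformlyOn.2 fun K hK => h z x₀ k K hK.1 hK.2

theorem contDiffOn_bilInChart {g : M → Bil E} (hg : ∀ p, IsSmoothAt g p) (x₀ : M) :
    ContDiffOn ℝ ∞ (bilInChart g x₀) (chartAt E x₀).target := by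
  intro y hy
  have h := (isSmoothAt_iff x₀ ((chartAt E x₀).map_target hy)).1 (hg ((chartAt E x₀).symm y))
  rw [(chartAt E x₀).right_inv hy] at h
  exact h.contDiffWithinAt

variable {Ω : Fin s → (p : M) → TangentSpace 𝓘(ℝ, E) p [⋀^Fin 2]→L[ℝ] ℝ}

/-- The path of compatible metrics from `g` to `g₀`. -/
def metricPath (hΩ : IsPolysymplectic n Ω) (Φ : Interpolation E n s) (g₀ : CompatibleMetric n Ω)
    (z : unitInterval × CompatibleMetric n Ω) : CompatibleMetric n Ω :=
  ⟨toMetric (S := fun j p => toBil E (Ω j p))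
    (Φ.field (fun j p => toBil E (Ω j p)) (metricField z.2.1) (metricField g₀.1) fun _ => z.1)
    (fun p => Φ.compat (isCompatible_iff.1 z.2.2 p) (isCompatible_iff.1 g₀.2 p) z.1.2)
    (fun p => Φ.isSmoothAt_field (isCompatible_iff.1 z.2.2) (isCompatible_iff.1 g₀.2)
      (fun _ => z.1.2) (fun j => isSmoothAt_toBil (hΩ.smooth j) p) (isSmoothAt_metricField _ p)
      (isSmoothAt_metricField _ p) contMDiffAt_const),
    isCompatible_iff.2 fun p =>
      Φ.compat (isCompatible_iff.1 z.2.2 p) (isCompatible_iff.1 g₀.2 p) z.1.2⟩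

theorem metricField_metricPath (hΩ : IsPolysymplectic n Ω) (Φ : Interpolation E n s)
    (g₀ : CompatibleMetric n Ω) (z : unitInterval × CompatibleMetric n Ω) :
    metricField (metricPath hΩ Φ g₀ z).1 = Φ.field (fun j p => toBil E (Ω j p))
      (metricField z.2.1) (metricField g₀.1) fun _ => z.1 := rfl

/-- In a chart the path is `Φ.toFun` composed with the tuple of the forms, the moving metric, `g₀`
and the constant function `t`. Each component converges with all derivatives on compact sets, and
composition preserves this. -/
theorem continuous_metricPath (hΩ : IsPolysymplectic n Ω) (Φ : Interpolation E n s)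
    (g₀ : CompatibleMetric n Ω) : Continuous (metricPath hΩ Φ g₀) := by
  refine continuous_induced_rng.2 (continuous_to_metric_iff.2 fun z x₀ k K hKc hK => ?_)
  have hU := (chartAt E x₀).open_target
  let S : Fin s → M → Bil E := fun j p => toBil E (Ω j p)
  let f : unitInterval × CompatibleMetric n Ω → E → (Fin s → Bil E) × Bil E × Bil E × ℝ :=
    fun z y => (fun j => bilInChart (S j) x₀ y, bilInChart (metricField z.2.1) x₀ y,
      bilInChart (metricField g₀.1) x₀ y, (z.1 : ℝ))
  let O : Set ((Fin s → Bil E) × Bil E × Bil E × ℝ) :=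
    {p | IsCompat n p.1 p.2.1 ∧ IsCompat n p.1 p.2.2.1 ∧ p.2.2.2 ∈ Set.Icc (0 : ℝ) 1}
  have hfO : ∀ z, Set.MapsTo (f z) (chartAt E x₀).target O := fun z y hy =>
    ⟨isCompat_bilInChart (isCompatible_iff.1 z.2.2) x₀ hy,
      isCompat_bilInChart (isCompatible_iff.1 g₀.2) x₀ hy, z.1.2⟩
  have hS : ContDiffOn ℝ ∞ (fun y j => bilInChart (S j) x₀ y) (chartAt E x₀).target :=
    contDiffOn_pi.2 fun j => contDiffOn_bilInChart (isSmoothAt_toBil (hΩ.smooth j)) x₀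
  have hg : ∀ g : SmoothMetric E M,
      ContDiffOn ℝ ∞ (bilInChart (metricField g) x₀) (chartAt E x₀).target := fun g =>
    contDiffOn_bilInChart (isSmoothAt_metricField g) x₀
  have ht : ∀ z : unitInterval × CompatibleMetric n Ω,
      ContDiffOn ℝ ∞ (fun _ : E => (z.1 : ℝ)) (chartAt E x₀).target := fun z => contDiffOn_const
  have key := tendstoUniformlyOn_iteratedFDeriv_comp (l := 𝓝 z) hU hKc hK k (Φ := Φ.toFun) (O := O)
    (fun p hp => Φ.smooth hp.1 hp.2.1 hp.2.2) (f := f) (f₀ := f z)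
    (fun z => hS.prodMk ((hg _).prodMk ((hg _).prodMk (ht z))))
    (hS.prodMk ((hg _).prodMk ((hg _).prodMk (ht z)))) hfO (hfO z) (fun m _ => by
      refine tendstoUniformlyOn_iteratedFDeriv_prodMk hU (fun _ => hS) hS
        (fun z => (hg _).prodMk ((hg _).prodMk (ht z))) ((hg _).prodMk ((hg _).prodMk (ht z))) hK
        (tendstoUniformlyOn_self _ _) ?_
      refine tendstoUniformlyOn_iteratedFDeriv_prodMk hU (fun z => hg _) (hg _)
        (fun z => (hg _).prodMk (ht z)) ((hg _).prodMk (ht z)) hK ?_ ?_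
      · exact continuous_to_metric_iff.1 (continuous_subtype_val.comp continuous_snd) z x₀ m K hKc hK
      refine tendstoUniformlyOn_iteratedFDeriv_prodMk hU (fun z => hg _) (hg _) ht (ht z) hK
        (tendstoUniformlyOn_self _ _) ?_
      exact tendstoUniformlyOn_iteratedFDeriv_const
        ((continuous_subtype_val.comp continuous_fst).tendsto z) K m)
  have heq : ∀ z, Set.EqOn (iteratedFDeriv ℝ k (Φ.toFun ∘ f z))
      (iteratedFDeriv ℝ k (bilInChart (metricField (metricPath hΩ Φ g₀ z).1) x₀)) K := by
    intro z y hy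
    refine Filter.EventuallyEq.eq_of_nhds (Filter.EventuallyEq.iteratedFDeriv ℝ ?_ k)
    filter_upwards [hU.mem_nhds (hK hy)] with y hy
    rw [metricField_metricPath]
    exact (Φ.bilInChart_field (isCompatible_iff.1 z.2.2) (isCompatible_iff.1 g₀.2)
      (fun _ => z.1.2) x₀ hy).symm
  exact (key.congr (Filter.Eventually.of_forall heq)).congr_right (heq z)

theorem contractibleSpace_compatibleMetric (hΩ : IsPolysymplectic n Ω) (Φ : Interpolation E n s)
    (g₀ : CompatibleMetric n Ω) : ContractibleSpace (CompatibleMetric n Ω) := by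
  rw [contractible_iff_id_nullhomotopic]
  refine ⟨g₀, ⟨⟨⟨metricPath hΩ Φ g₀, continuous_metricPath hΩ Φ g₀⟩, fun g => ?_, fun g => ?_⟩⟩⟩
  · refine Subtype.ext (metric_ext (funext fun p => ?_))
    exact Φ.zero (isCompatible_iff.1 g.2 p) (isCompatible_iff.1 g₀.2 p)
  · refine Subtype.ext (metric_ext (funext fun p => ?_))
    exact Φ.one (isCompatible_iff.1 g.2 p) (isCompatible_iff.1 g₀.2 p)

end Contraction

end Polysymplectic

end

theorem mainTheorem8 {E : Type*} [NormedAddCommGroup E] [NormedSpace ℝ E] [FiniteDimensional ℝ E]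
    {M : Type*} [TopologicalSpace M] [T2Space M] [SecondCountableTopology M] [ChartedSpace E M]
    [IsManifold 𝓘(ℝ, E) ∞ M] (n s : ℕ) (hs : 1 ≤ s)
    (Ω : Fin s → (p : M) → TangentSpace 𝓘(ℝ, E) p [⋀^Fin 2]→L[ℝ] ℝ)
    (hΩ : Polysymplectic.IsPolysymplectic n Ω) :
    Nonempty (Polysymplectic.CompatibleMetric n Ω) ∧
      ContractibleSpace (Polysymplectic.CompatibleMetric n Ω) := by
  obtain ⟨g₀⟩ := Polysymplectic.nonempty_compatibleMetric hs hΩ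
  obtain ⟨Φ⟩ := Polysymplectic.nonempty_interpolation E n hs
  exact ⟨⟨g₀⟩, Polysymplectic.contractibleSpace_compatibleMetric hΩ Φ g₀⟩
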